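/- Let $d\ge 1$, let $f$ (the target), $q_0$ (the safe density) and $K$ (the kernel) be probability densities on $\mathbb R^d$, and let $(\lambda_k)_{k\ge1}$, $(h_k)_{k\ge1}$, $(\eta_k)_{k\ge1}$ be real sequences. Let $X_1,X_2,\dots$ be $\mathbb R^d$-valued random variables on a probability space, $\mathcal F_k=\sigma(X_1,\dots,X_k)$ (with $\mathcal F_0$ trivial), such that for every $k\ge1$, conditionally on $\mathcal F_{k-1}$, $X_k$ has density $q_{k-1}$, where for $n\ge1$ $$q_n=(1-\lambda_n)f_n+\lambda_nq_0,\qquad f_n(x)=\sum_{k=1}^n w_{n,k}\,\frac1{h_n^d}K\Big(\frac{x-X_k}{h_n}\Big),\qquad w_{n,k}=\frac{W_k^{\eta_k}}{\sum_{j=1}^nW_j^{\eta_j}},\qquad W_k=\frac{f(X_k)}{q_{k-1}(X_k)}$$ (if $W_1=\dots=W_n=0$, put $w_{n,k}=1/n$). Assume: (A1) (i) $(\lambda_k)$ takes values in $(0,1]$, is nonincreasing, $\lambda_k\to0$ and $\log(k)/(k\lambda_k)\to0$; (ii) $(h_k)$ takes values in $(0,\infty)$, is nonincreasing, $h_k\to0$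 and $\log(k)/(kh_k^d\lambda_k)\to0$; (iii) $(\eta_k)$ takes values in $(0,1]$, $\eta_k\to1$, $(1-\eta_k)\log(h_k)\to0$ and $(1-\eta_k)\log(\lambda_{k-1})\to0$, all as $k\to\infty$. (A2) $q_0$ is bounded and there is $c>0$ with $q_0(x)\ge c f(x)$ for all $x\in\mathbb R^d$. (A3) $f$ is Lipschitz and bounded. (A4) $\int\|u\|K(u)\,du<\infty$, $\int K(u)^{1/2}\,du<\infty$, $\int\|u\|K(u)^{1/2}\,du<\infty$, and $K$ is bounded and Lipschitz. Then for every $r>0$, almost surely, $$\sup_{\|x\|\le n^r}|f_n(x)-f(x)|\longrightarrow0\qquad\text{as }n\to\infty.$$ -/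

import Mathlib

open MeasureTheory Filter Topology

noncomputable section

/-- The points `ℝ^d` with the Euclidean norm and Lebesgue measure. -/
abbrev Pt (d : ℕ) : Type := EuclideanSpace ℝ (Fin d)

/-- A probability density on `ℝ^d` with respect to Lebesgue measure. -/
structure IsProbDensity {d : ℕ} (g : Pt d → ℝ) : Prop where
  measurable : Measurable g
  nonneg : ∀ x, 0 ≤ g x
  integrable : Integrable g
  integral_eq_one : ∫ x, g x = 1

/-- The rescaled kernel `K_h(u) = K(u / h) / h ^ d`. -/
def scaledKernel {d : ℕ} (K : Pt d → ℝ) (h : ℝ) (u : Pt d) : ℝ :=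
  K (h⁻¹ • u) / h ^ d

/-- The weights proportional to `v 1, …, v n` that sum to one. If `v 1 + ⋯ + v n = 0`
(for nonnegative `v`: if all of them vanish), equal weights `1 / n` are used. -/
def normalizedWeight (v : ℕ → ℝ) (n k : ℕ) : ℝ :=
  if ∑ j ∈ Finset.Icc 1 n, v j = 0 then 1 / (n : ℝ) else v k / ∑ j ∈ Finset.Icc 1 n, v j

/-- The kernel density estimate with bandwidth `h` at the points `x 1, …, x n`, where the
weights are obtained by normalizing `v 1, …, v n`. -/
def weightedKDE {d : ℕ} (K : Pt d → ℝ) (h : ℝ) (x : ℕ → Pt d) (v : ℕ → ℝ) (n : ℕ)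
    (y : Pt d) : ℝ :=
  ∑ k ∈ Finset.Icc 1 n, normalizedWeight v n k * scaledKernel K h (y - x k)

/-- The proposal `q_n` of the algorithm with target `f`, safe density `q₀`, kernel `K`, mixture
weights `lam`, bandwidths `h` and learning rates `eta`, as a function of the particles
`x 1, x 2, …` (only `x 1, …, x n` are used). The guard `k - 1 < m + 1` always holds for the
indices `1 ≤ k ≤ m + 1` that enter the estimate; it is there for the recursion only. -/
def proposal {d : ℕ} (f q₀ K : Pt d → ℝ) (lam h eta : ℕ → ℝ) (x : ℕ → Pt d) :
    ℕ → Pt d → ℝ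
  | 0 => q₀
  | m + 1 => fun y =>
      (1 - lam (m + 1)) * weightedKDE K (h (m + 1)) x
        (fun k => if _hk : k - 1 < m + 1 then
          (f (x k) / proposal f q₀ K lam h eta x (k - 1) (x k)) ^ eta k else 0) (m + 1) y
      + lam (m + 1) * q₀ y
  termination_by n => n

/-- The importance weight `W_k = f(x_k) / q_{k-1}(x_k)`, for `k ≥ 1`. -/
def importanceWeight {d : ℕ} (f q₀ K : Pt d → ℝ) (lam h eta : ℕ → ℝ) (x : ℕ → Pt d)
    (k : ℕ) : ℝ :=
  f (x k) / proposal f q₀ K lam h eta x (k - 1) (x k)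

/-- The estimate `f_n` of `f`: the kernel density estimate with bandwidth `h n` whose weights are
the normalized regularized importance weights `W_k ^ eta k`, `1 ≤ k ≤ n`. -/
def targetEstimate {d : ℕ} (f q₀ K : Pt d → ℝ) (lam h eta : ℕ → ℝ) (x : ℕ → Pt d)
    (n : ℕ) (y : Pt d) : ℝ :=
  weightedKDE K (h n) x (fun k => importanceWeight f q₀ K lam h eta x k ^ eta k) n y

theorem weightedKDE_congr {d : ℕ} (K : Pt d → ℝ) (h : ℝ) (x : ℕ → Pt d) (v w : ℕ → ℝ) (n : ℕ)
    (hvw : ∀ k ∈ Finset.Icc 1 n, v k = w k) (y : Pt d) :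
    weightedKDE K h x v n y = weightedKDE K h x w n y := by
  unfold weightedKDE
  apply Finset.sum_congr rfl
  intro k hk
  unfold normalizedWeight
  rw [Finset.sum_congr rfl hvw, hvw k hk]

theorem proposal_zero {d : ℕ} (f q₀ K : Pt d → ℝ) (lam h eta : ℕ → ℝ) (x : ℕ → Pt d) :
    proposal f q₀ K lam h eta x 0 = q₀ := by
  rw [proposal]

/-- The update rule `q_n = (1 - λ_n) f_n + λ_n q_0` for `n ≥ 1`. -/
theorem proposal_of_one_le {d : ℕ} (f q₀ K : Pt d → ℝ) (lam h eta : ℕ → ℝ) (x : ℕ → Pt d)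
    (n : ℕ) (hn : 1 ≤ n) (y : Pt d) :
    proposal f q₀ K lam h eta x n y =
      (1 - lam n) * targetEstimate f q₀ K lam h eta x n y + lam n * q₀ y := by
  obtain ⟨m, rfl⟩ : ∃ m, n = m + 1 := ⟨n - 1, by omega⟩
  rw [proposal, targetEstimate]
  beta_reduce
  rw [weightedKDE_congr K (h (m + 1)) x _
    (fun k => importanceWeight f q₀ K lam h eta x k ^ eta k) (m + 1) ?_ y]
  intro k hk
  rw [Finset.mem_Icc] at hk
  have hk' : k - 1 < m + 1 := by omega
  simp only [hk', dif_pos, importanceWeight]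

/-- The σ-algebra `ℱ_k` generated by `X 1, …, X k` (trivial for `k = 0`). -/
abbrev pastSigma {Ω : Type*} {d : ℕ} (X : ℕ → Ω → Pt d) (k : ℕ) : MeasurableSpace Ω :=
  ⨆ j ∈ Finset.Icc 1 k, MeasurableSpace.comap (X j) inferInstance

/-- The sequence `X 1, X 2, …` of random variables has policy `q 0, q 1, …`: for every `k ≥ 1`,
conditionally on `ℱ_{k-1}`, the law of `X k` has the (random) density `q (k - 1)`. -/
structure HasPolicy {Ω : Type*} [MeasurableSpace Ω] {d : ℕ} (P : Measure Ω)
    (X : ℕ → Ω → Pt d) (q : ℕ → Ω → Pt d → ℝ) : Prop where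
  measurable : ∀ k, 1 ≤ k → Measurable (X k)
  cond_law : ∀ k, 1 ≤ k → ∀ B : Set (Pt d), MeasurableSet B →
    P[(X k ⁻¹' B).indicator (fun _ => (1 : ℝ)) | pastSigma X (k - 1)]
      =ᵐ[P] fun ω => ∫ y in B, q (k - 1) ω y

end

/-! Up to the common factor `1 / n`, the estimate is a ratio: a weighted kernel sum over a sum of
weights. Both have the form `∑ W_k ^ eta k * g (X k)`. Given the past, the mean of a summand is `∫
g_k * g` with `g_k = f ^ eta k * q_{k-1} ^ (1 - eta k)` (`tiltedTarget`).

No consistency of the proposals is needed to control `g_k`, so the argument is not circular. The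
safe component gives `q_{k-1} ≥ c * lam (k-1) * f` for `k ≥ 2`, and boundedness of the kernel gives
`q_{k-1} ≤ A / h k ^ d`. These bounds enter `g_k` only through their powers with exponent `1 - eta
k`, which tend to one by the assumptions on `(1 - eta k) * log`. Hence `g_k` is uniformly close to
`f`, with a deterministic error tending to zero (`abs_tiltedTarget_sub_le`, `tendsto_tiltError`).
Cesàro averaging and the Lipschitz property of `f` make the averaged conditional means converge to
`1` for the weights, and to `f z` uniformly in `z` for the kernel sums.

The fluctuations are martingale sums. Weights up to time `n` are `O(1 / lam n)` and kernel values
are `O(1 / h n ^ d)`, while conditional means stay bounded. A Chernoff bound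
(`measure_abs_sum_sub_mean_ge_le`) then has exponent of order `n * h n ^ d * lam n`, which dominates
`log n`. It survives a union bound over a polynomially large net, and Borel–Cantelli makes it almost
sure. A mesh of order `n ^ (-4)` beats the Lipschitz constant of the kernel sums. -/

/-! ### Truncated paths and policies -/

/-- The path that agrees with `x` at the times `1, …, k` and vanishes at all other times. -/
def pathTrunc {d : ℕ} (k : ℕ) (x : ℕ → Pt d) : ℕ → Pt d :=
  fun j => if j ∈ Finset.Icc 1 k then x j else 0

/-- A jointly measurable family of probability densities `q k x`, where `q k x` depends on the
path `x` only through `x 1, …, x k`. -/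
structure IsPolicyDensity {d : ℕ} (q : ℕ → (ℕ → Pt d) → Pt d → ℝ) : Prop where
  measurable : ∀ k, Measurable (Function.uncurry (q k))
  density : ∀ k x, IsProbDensity (q k x)
  pathTrunc_eq : ∀ k x, q k (pathTrunc k x) = q k x

theorem pathTrunc_apply_of_mem {d k j : ℕ} (hj : j ∈ Finset.Icc 1 k) (x : ℕ → Pt d) :
    pathTrunc k x j = x j := by
  simp only [pathTrunc, hj, if_true]

theorem pathTrunc_pathTrunc {d k m : ℕ} (hkm : k ≤ m) (x : ℕ → Pt d) :
    pathTrunc k (pathTrunc m x) = pathTrunc k x := by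
  funext j
  by_cases hj : j ∈ Finset.Icc 1 k
  · have hj' : j ∈ Finset.Icc 1 m := by
      rw [Finset.mem_Icc] at hj ⊢
      omega
    rw [pathTrunc_apply_of_mem hj, pathTrunc_apply_of_mem hj', pathTrunc_apply_of_mem hj]
  · simp only [pathTrunc, hj, if_false]

/-- Events of the truncated path lie in the past, so the defining identity of conditional
expectation can be integrated over them. -/
theorem measurable_pathTrunc_pastSigma {Ω : Type*} {d : ℕ} (X : ℕ → Ω → Pt d) (k : ℕ) :
    Measurable[pastSigma X k] (fun ω => pathTrunc k (fun j => X j ω)) := by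
  refine @measurable_pi_lambda _ _ _ (pastSigma X k) _ _ fun j => ?_
  by_cases hj : j ∈ Finset.Icc 1 k
  · simp only [pathTrunc, hj, if_true]
    rw [measurable_iff_comap_le]
    exact le_iSup₂_of_le j hj le_rfl
  · simp only [pathTrunc, hj, if_false]
    exact measurable_const

/-! ### Conditional laws and exponential martingale inequalities -/

section Policy

variable {Ω : Type*} [MeasurableSpace Ω] {P : Measure Ω} {d : ℕ} {X : ℕ → Ω → Pt d}
  {q : ℕ → (ℕ → Pt d) → Pt d → ℝ}

theorem pastSigma_le {q' : ℕ → Ω → Pt d → ℝ} (hX : HasPolicy P X q') (k : ℕ) :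
    pastSigma X k ≤ ‹MeasurableSpace Ω› := by
  refine iSup₂_le fun j hj => ?_
  exact (hX.measurable j (Finset.mem_Icc.1 hj).1).comap_le

theorem measurable_pathTrunc_comp {q' : ℕ → Ω → Pt d → ℝ} (hX : HasPolicy P X q') (k : ℕ) :
    Measurable (fun ω => pathTrunc k (fun j => X j ω)) :=
  (measurable_pathTrunc_pastSigma X k).mono (pastSigma_le hX k) le_rfl

/-- Conditional law of the next particle, in the form of an integral identity. -/
theorem lintegral_pathTrunc_policy [IsProbabilityMeasure P] (hq : IsPolicyDensity q)
    (hX : HasPolicy P X fun k ω => q k fun j => X j ω) (k : ℕ)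
    (G : (ℕ → Pt d) × Pt d → ENNReal) (hG : Measurable G) :
    ∫⁻ ω, G (pathTrunc k (fun j => X j ω), X (k + 1) ω) ∂P =
      ∫⁻ ω, (∫⁻ y, ENNReal.ofReal (q k (fun j => X j ω) y) *
        G (pathTrunc k (fun j => X j ω), y)) ∂P := by
  set T : Ω → ℕ → Pt d := fun ω => pathTrunc k (fun j => X j ω) with hT
  have hTm : Measurable T := measurable_pathTrunc_comp hX k
  have hXm : Measurable (X (k + 1)) := hX.measurable (k + 1) (by omega)
  have hdens : Measurable (Function.uncurry fun x y => ENNReal.ofReal (q k x y)) :=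
    ENNReal.measurable_ofReal.comp (hq.measurable k)
  let κ : ProbabilityTheory.Kernel (ℕ → Pt d) (Pt d) :=
    ProbabilityTheory.Kernel.withDensity
      (ProbabilityTheory.Kernel.const (ℕ → Pt d) (volume : Measure (Pt d)))
      (fun x y => ENNReal.ofReal (q k x y))
  have hκ : ∀ x B, κ x B = ∫⁻ y in B, ENNReal.ofReal (q k x y) := by
    intro x B
    rw [ProbabilityTheory.Kernel.withDensity_apply' _ hdens]
    rfl
  have hmass : ∀ x, ∫⁻ y, ENNReal.ofReal (q k x y) = 1 := by
    intro x
    rw [← ofReal_integral_eq_lintegral_ofReal (hq.density k x).integrable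
      (ae_of_all _ (hq.density k x).nonneg), (hq.density k x).integral_eq_one,
      ENNReal.ofReal_one]
  have : ProbabilityTheory.IsMarkovKernel κ := by
    refine ⟨fun x => ⟨?_⟩⟩
    rw [hκ, Measure.restrict_univ, hmass]
  have hprob : IsProbabilityMeasure (P.map T) := Measure.isProbabilityMeasure_map hTm.aemeasurable
  have hlaw : P.map (fun ω => (T ω, X (k + 1) ω)) = (P.map T).compProd κ := by
    have : IsProbabilityMeasure (P.map (fun ω => (T ω, X (k + 1) ω))) :=
      Measure.isProbabilityMeasure_map (hTm.prodMk hXm).aemeasurable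
    -- Rectangles determine the joint law. For a rectangle, the condition on the path is an event of
    -- the past, and integrating the conditional probability over it gives the identity.
    refine Measure.ext_prod ?_
    intro A B hA hB
    have hTA : MeasurableSet[pastSigma X k] (T ⁻¹' A) := measurable_pathTrunc_pastSigma X k hA
    have hTA' : MeasurableSet (T ⁻¹' A) := hTm hA
    have hXB : MeasurableSet (X (k + 1) ⁻¹' B) := hXm hB
    rw [Measure.map_apply (hTm.prodMk hXm) (hA.prod hB), Measure.compProd_apply_prod hA hB,
      setLIntegral_map hA (κ.measurable_coe hB) hTm]
    have hpre : (fun ω => (T ω, X (k + 1) ω)) ⁻¹' A ×ˢ B = T ⁻¹' A ∩ X (k + 1) ⁻¹' B := rfl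
    rw [hpre]
    have hq0 : ∀ ω, ∫ y in B, q k (fun j => X j ω) y = (κ (T ω) B).toReal := by
      intro ω
      rw [hκ, hT, hq.pathTrunc_eq, ← ofReal_integral_eq_lintegral_ofReal
        (hq.density k _).integrable.integrableOn
        (ae_of_all _ (hq.density k _).nonneg), ENNReal.toReal_ofReal]
      exact setIntegral_nonneg_of_ae (ae_of_all _ (hq.density k _).nonneg)
    have hce := hX.cond_law (k + 1) (by omega) B hB
    have h1 : ∫ ω in T ⁻¹' A, (κ (T ω) B).toReal ∂P =
        ∫ ω in T ⁻¹' A, (X (k + 1) ⁻¹' B).indicator (fun _ => (1 : ℝ)) ω ∂P := by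
      rw [← setIntegral_condExp (pastSigma_le hX k)
        ((integrable_const (1 : ℝ)).indicator hXB) hTA]
      refine setIntegral_congr_ae hTA' ?_
      filter_upwards [hce] with ω hω _
      rw [← hq0 ω]
      exact hω.symm
    rw [integral_indicator hXB, setIntegral_const, smul_eq_mul, mul_one,
      measureReal_restrict_apply' hTA',
      integral_toReal (f := fun ω => κ (T ω) B)
        ((κ.measurable_coe hB).comp hTm).aemeasurable
        (ae_of_all _ fun ω => measure_lt_top _ _)] at h1
    have h2 : ∫⁻ ω in T ⁻¹' A, κ (T ω) B ∂P ≠ ⊤ := by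
      refine ne_of_lt (lt_of_le_of_lt (lintegral_mono fun ω => prob_le_one) ?_)
      rw [lintegral_one]
      exact measure_lt_top _ _
    rw [Measure.real, ENNReal.toReal_eq_toReal_iff' h2 (measure_ne_top _ _)] at h1
    rw [h1, Set.inter_comm]
  have hGm : Measurable fun ω => (T ω, X (k + 1) ω) := hTm.prodMk hXm
  calc ∫⁻ ω, G (T ω, X (k + 1) ω) ∂P
      = ∫⁻ z, G z ∂(P.map (fun ω => (T ω, X (k + 1) ω))) := (lintegral_map hG hGm).symm
    _ = ∫⁻ x, ∫⁻ y, G (x, y) ∂(κ x) ∂(P.map T) := by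
        rw [hlaw, Measure.lintegral_compProd hG]
    _ = ∫⁻ ω, ∫⁻ y, G (T ω, y) ∂(κ (T ω)) ∂P :=
        lintegral_map hG.lintegral_kernel_prod_right' hTm
    _ = _ := by
        refine lintegral_congr fun ω => ?_
        have hwd := ProbabilityTheory.Kernel.lintegral_withDensity
          (ProbabilityTheory.Kernel.const (ℕ → Pt d) (volume : Measure (Pt d))) hdens (T ω)
          (g := fun y => G (T ω, y)) (hG.comp measurable_prodMk_left)
        rw [ProbabilityTheory.Kernel.const_apply] at hwd
        refine hwd.trans ?_
        simp only [hT, hq.pathTrunc_eq]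

/-- Exponential moment bound for the increments of a process driven by the policy. -/
theorem lintegral_exp_density_le_one {g : Pt d → ℝ} (hg : IsProbDensity g) {z : Pt d → ℝ}
    (hz : Measurable z) (hz1 : ∀ y, |z y| ≤ 1) {s : ℝ} (hs : ∫ y, z y ^ 2 * g y ≤ s) :
    ∫⁻ y, ENNReal.ofReal (g y) * ENNReal.ofReal (Real.exp (z y - (∫ y, z y * g y) - s)) ≤ 1 := by
  have hint1 : Integrable fun y => z y * g y :=
    hg.integrable.bdd_mul hz.aestronglyMeasurable (ae_of_all _ fun y => by simpa using hz1 y)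
  have hint2 : Integrable fun y => z y ^ 2 * g y := by
    refine hg.integrable.bdd_mul (c := 1) (hz.pow_const 2).aestronglyMeasurable
      (ae_of_all _ fun y => ?_)
    rw [Real.norm_eq_abs, abs_pow]
    exact pow_le_one₀ (abs_nonneg _) (hz1 y)
  set a := ∫ y, z y * g y with ha
  have hI : ∫ y, (g y + z y * g y + z y ^ 2 * g y) * Real.exp (-a - s) ≤ 1 := by
    rw [integral_mul_const, integral_add (f := fun y => g y + z y * g y)
      (hg.integrable.add hint1) hint2,
      integral_add hg.integrable hint1, hg.integral_eq_one, ← ha]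
    -- The second-order bound `exp z ≤ 1 + z + z ^ 2` for `|z| ≤ 1` integrates to `1 + a + E[z ^
    -- 2]`, and `1 + t ≤ exp t` turns this into the exponential that the compensator cancels.
    have h1 : 1 + a + ∫ y, z y ^ 2 * g y ≤ Real.exp (a + s) := by
      have := Real.add_one_le_exp (a + s)
      linarith
    calc _ ≤ Real.exp (a + s) * Real.exp (-a - s) :=
          mul_le_mul_of_nonneg_right h1 (Real.exp_pos _).le
      _ = 1 := by rw [← Real.exp_add]; simp
  have hnn : ∀ y, 0 ≤ (g y + z y * g y + z y ^ 2 * g y) * Real.exp (-a - s) := by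
    intro y
    refine mul_nonneg ?_ (Real.exp_pos _).le
    have h1 : 0 ≤ (1 + z y + z y ^ 2) * g y :=
      mul_nonneg (by nlinarith [neg_le_of_abs_le (hz1 y)]) (hg.nonneg y)
    linarith
  calc _ ≤ ∫⁻ y, ENNReal.ofReal ((g y + z y * g y + z y ^ 2 * g y) * Real.exp (-a - s)) := by
        refine lintegral_mono fun y => ?_
        rw [← ENNReal.ofReal_mul (hg.nonneg y)]
        refine ENNReal.ofReal_le_ofReal ?_
        have h1 : Real.exp (z y) ≤ 1 + z y + z y ^ 2 := by
          have := le_of_abs_le (Real.abs_exp_sub_one_sub_id_le (hz1 y))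
          linarith
        have h2 : Real.exp (z y - a - s) = Real.exp (z y) * Real.exp (-a - s) := by
          rw [← Real.exp_add]; ring_nf
        rw [h2, ← mul_assoc]
        refine mul_le_mul_of_nonneg_right ?_ (Real.exp_pos _).le
        have := mul_le_mul_of_nonneg_left h1 (hg.nonneg y)
        linarith
    _ = ENNReal.ofReal (∫ y, (g y + z y * g y + z y ^ 2 * g y) * Real.exp (-a - s)) := by
        rw [ofReal_integral_eq_lintegral_ofReal _ (ae_of_all _ hnn)]
        exact ((hg.integrable.add hint1).add hint2).mul_const _
    _ ≤ 1 := by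
        rw [← ENNReal.ofReal_one]
        exact ENNReal.ofReal_le_ofReal hI

/-- Chernoff bound for the martingale with increments `Z k (X k) - E[Z k (X k) | ℱ_{k-1}]`. -/
theorem measure_sum_sub_mean_ge_le [IsProbabilityMeasure P] (hq : IsPolicyDensity q)
    (hX : HasPolicy P X fun k ω => q k fun j => X j ω)
    {Z : ℕ → (ℕ → Pt d) → Pt d → ℝ} (hZ : ∀ k, Measurable (Function.uncurry (Z k)))
    (hZT : ∀ k x, Z (k + 1) (pathTrunc k x) = Z (k + 1) x) {n : ℕ}
    (hZ1 : ∀ k ∈ Finset.Icc 1 n, ∀ x y, |Z k x y| ≤ 1) {s : ℝ}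
    (hs : ∀ k ∈ Finset.Icc 1 n, ∀ x, ∫ y, Z k x y ^ 2 * q (k - 1) x y ≤ s) (u : ℝ) :
    P {ω | n * s + u ≤ ∑ k ∈ Finset.Icc 1 n, (Z k (fun j => X j ω) (X k ω) -
      ∫ y, Z k (fun j => X j ω) y * q (k - 1) (fun j => X j ω) y)} ≤
      ENNReal.ofReal (Real.exp (-u)) := by
  -- Subtracting `s` at each step makes `exp (S m)` a supermartingale started at `1`.
  obtain ⟨S, hS⟩ : ∃ S : ℕ → (ℕ → Pt d) → ℝ, S = fun m x => ∑ k ∈ Finset.Icc 1 m,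
    (Z k x (x k) - (∫ y, Z k x y * q (k - 1) x y) - s) := ⟨_, rfl⟩
  have hmean : ∀ k, Measurable fun x => ∫ y, Z k x y * q (k - 1) x y := by
    intro k
    have h : Measurable (Function.uncurry fun x y => Z k x y * q (k - 1) x y) :=
      (hZ k).mul (hq.measurable (k - 1))
    exact h.stronglyMeasurable.integral_prod_right.measurable
  have hSm : ∀ m, Measurable (S m) := by
    intro m
    rw [hS]
    refine Finset.measurable_sum _ fun k _ => ?_
    exact (((hZ k).comp (measurable_id.prodMk (measurable_pi_apply k))).sub (hmean k)).sub_const s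
  have hZT' : ∀ m, ∀ k ∈ Finset.Icc 1 (m + 1), ∀ x, Z k (pathTrunc m x) = Z k x := by
    intro m k hk x
    rw [Finset.mem_Icc] at hk
    obtain ⟨i, rfl⟩ : ∃ i, k = i + 1 := ⟨k - 1, by omega⟩
    rw [← hZT i, pathTrunc_pathTrunc (by omega), hZT]
  have hqT' : ∀ m, ∀ k ≤ m, ∀ x, q k (pathTrunc m x) = q k x := by
    intro m k hk x
    rw [← hq.pathTrunc_eq k, pathTrunc_pathTrunc hk, hq.pathTrunc_eq]
  -- `S m` is a function of the truncated path alone, hence a constant factor when the next particle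
  -- is integrated out.
  have hST : ∀ m x, S m (pathTrunc m x) = S m x := by
    intro m x
    simp only [hS]
    refine Finset.sum_congr rfl fun k hk => ?_
    rw [hZT' m k (Finset.mem_Icc.2 ⟨(Finset.mem_Icc.1 hk).1, by
      have := (Finset.mem_Icc.1 hk).2; omega⟩), hqT' m (k - 1) (by
      have := (Finset.mem_Icc.1 hk).2; omega), pathTrunc_apply_of_mem hk]
  have hstep : ∀ m x, S (m + 1) x = S m x + (Z (m + 1) x (x (m + 1)) -
      (∫ y, Z (m + 1) x y * q m x y) - s) := by
    intro m x
    simp only [hS]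
    rw [Finset.sum_Icc_succ_top (by omega)]
    simp
  have hexp : ∀ m ≤ n, ∫⁻ ω, ENNReal.ofReal (Real.exp (S m fun j => X j ω)) ∂P ≤ 1 := by
    intro m
    induction m with
    | zero => intro _; simp [hS]
    | succ m ih =>
      intro hm
      refine le_trans ?_ (ih (by omega))
      let G : (ℕ → Pt d) × Pt d → ENNReal := fun p =>
        ENNReal.ofReal (Real.exp (S m p.1)) * ENNReal.ofReal (Real.exp (Z (m + 1) p.1 p.2 -
          (∫ y, Z (m + 1) p.1 y * q m p.1 y) - s))
      have hG : Measurable G := by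
        have h1 : Measurable fun p : (ℕ → Pt d) × Pt d => S m p.1 := (hSm m).comp measurable_fst
        have h2 : Measurable fun p : (ℕ → Pt d) × Pt d => Z (m + 1) p.1 p.2 := hZ (m + 1)
        have h3 : Measurable fun p : (ℕ → Pt d) × Pt d => ∫ y, Z (m + 1) p.1 y * q m p.1 y :=
          (hmean (m + 1)).comp measurable_fst
        exact h1.exp.ennreal_ofReal.mul ((h2.sub h3).sub_const s).exp.ennreal_ofReal
      have hGT : ∀ x y, G (pathTrunc m x, y) = G (x, y) := by
        intro x y
        simp only [G]
        rw [hST, hZT, hqT' m m le_rfl]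
      have h1 : ∀ ω, ENNReal.ofReal (Real.exp (S (m + 1) fun j => X j ω)) =
          G (pathTrunc m (fun j => X j ω), X (m + 1) ω) := by
        intro ω
        rw [hGT, hstep, Real.exp_add, ENNReal.ofReal_mul (Real.exp_pos _).le]
      rw [lintegral_congr h1, lintegral_pathTrunc_policy hq hX m G hG]
      refine lintegral_mono fun ω => ?_
      have hmem : m + 1 ∈ Finset.Icc 1 n := Finset.mem_Icc.2 ⟨by omega, hm⟩
      have h2 := lintegral_exp_density_le_one (hq.density m fun j => X j ω)
        ((hZ (m + 1)).comp measurable_prodMk_left) (hZ1 (m + 1) hmem fun j => X j ω)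
        (hs (m + 1) hmem fun j => X j ω)
      simp only [hGT]
      calc _ = ∫⁻ y, ENNReal.ofReal (Real.exp (S m fun j => X j ω)) *
            (ENNReal.ofReal (q m (fun j => X j ω) y) *
            ENNReal.ofReal (Real.exp (Z (m + 1) (fun j => X j ω) y -
            (∫ y, Z (m + 1) (fun j => X j ω) y * q m (fun j => X j ω) y) - s))) := by
            refine lintegral_congr fun y => ?_
            simp only [G]
            ring
        _ = ENNReal.ofReal (Real.exp (S m fun j => X j ω)) *
            ∫⁻ y, ENNReal.ofReal (q m (fun j => X j ω) y) *
            ENNReal.ofReal (Real.exp (Z (m + 1) (fun j => X j ω) y -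
            (∫ y, Z (m + 1) (fun j => X j ω) y * q m (fun j => X j ω) y) - s)) :=
            lintegral_const_mul' _ _ ENNReal.ofReal_ne_top
        _ ≤ ENNReal.ofReal (Real.exp (S m fun j => X j ω)) * 1 := by
            gcongr
            exact h2
        _ = _ := mul_one _
  have hmeasS : Measurable fun ω => S n fun j => X j ω := by
    have : (fun ω => S n fun j => X j ω) = fun ω => S n (pathTrunc n fun j => X j ω) := by
      funext ω
      rw [hST]
    rw [this]
    exact (hSm n).comp (measurable_pathTrunc_comp hX n)
  have hmarkov := mul_meas_ge_le_lintegral (μ := P) hmeasS.exp.ennreal_ofReal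
    (ENNReal.ofReal (Real.exp u))
  have hle : P {ω | ENNReal.ofReal (Real.exp u) ≤
      ENNReal.ofReal (Real.exp (S n fun j => X j ω))} ≤ ENNReal.ofReal (Real.exp (-u)) := by
    rw [Real.exp_neg, ENNReal.ofReal_inv_of_pos (Real.exp_pos u), ENNReal.le_inv_iff_mul_le,
      mul_comm]
    exact hmarkov.trans (hexp n le_rfl)
  refine le_trans (measure_mono ?_) hle
  intro ω hω
  simp only [Set.mem_ofPred_eq] at hω ⊢
  refine ENNReal.ofReal_le_ofReal (Real.exp_le_exp.2 ?_)
  simp only [hS]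
  rw [Finset.sum_sub_distrib, Finset.sum_const, Nat.card_Icc, nsmul_eq_mul]
  simp only [Nat.add_sub_cancel]
  linarith

end Policy

/-- Since `0 ≤ Y ≤ b`, one has `Y ^ 2 ≤ b * Y`, so the conditional second moment is at most `b * m`:
the exponent loses one factor `b`, not two. The one-sided bound is applied to `± (σ / b) * Y`; the
free parameter `σ ≤ 1` is to be tuned to `t / m`. -/
theorem measure_abs_sum_sub_mean_ge_le {Ω : Type*} [MeasurableSpace Ω] {P : Measure Ω} {d : ℕ}
    {X : ℕ → Ω → Pt d} {q : ℕ → (ℕ → Pt d) → Pt d → ℝ} [IsProbabilityMeasure P]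
    (hq : IsPolicyDensity q) (hX : HasPolicy P X fun k ω => q k fun j => X j ω)
    {Y : ℕ → (ℕ → Pt d) → Pt d → ℝ} (hY : ∀ k, Measurable (Function.uncurry (Y k)))
    (hYT : ∀ k x, Y (k + 1) (pathTrunc k x) = Y (k + 1) x) {n : ℕ} {b m t σ : ℝ} (hb : 0 < b)
    (hY0 : ∀ k ∈ Finset.Icc 1 n, ∀ x y, 0 ≤ Y k x y)
    (hYb : ∀ k ∈ Finset.Icc 1 n, ∀ x y, Y k x y ≤ b)
    (hm : ∀ k ∈ Finset.Icc 1 n, ∀ x, ∫ y, Y k x y * q (k - 1) x y ≤ m)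
    (hσ0 : 0 < σ) (hσ1 : σ ≤ 1) :
    P {ω | n * t ≤ |∑ k ∈ Finset.Icc 1 n, (Y k (fun j => X j ω) (X k ω) -
      ∫ y, Y k (fun j => X j ω) y * q (k - 1) (fun j => X j ω) y)|} ≤
      ENNReal.ofReal (2 * Real.exp (-(n / b * (σ * (t - σ * m))))) := by
  have hone : ∀ r : ℝ, |r| = σ / b →
      P {ω | (σ / b) * (n * t) ≤ r * ∑ k ∈ Finset.Icc 1 n, (Y k (fun j => X j ω) (X k ω) -
      ∫ y, Y k (fun j => X j ω) y * q (k - 1) (fun j => X j ω) y)} ≤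
      ENNReal.ofReal (Real.exp (-(n / b * (σ * (t - σ * m))))) := by
    intro r hr
    have hr2 : r ^ 2 = σ / b * (σ / b) := by rw [← sq_abs, hr, sq]
    refine le_trans (measure_mono ?_) (measure_sum_sub_mean_ge_le hq hX
      (Z := fun k x y => r * Y k x y) (fun k => (hY k).const_mul r)
      (fun k x => by simp only [hYT]) (n := n) ?_ (s := σ / b * σ * m) ?_ _)
    · intro ω hω
      simp only [Set.mem_ofPred_eq] at hω ⊢
      simp_rw [mul_assoc r, integral_const_mul, ← mul_sub]
      rw [← Finset.mul_sum]
      refine le_trans (le_of_eq ?_) hω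
      field_simp
      ring
    · intro k hk x y
      rw [abs_mul, hr, abs_of_nonneg (hY0 k hk x y)]
      calc σ / b * Y k x y ≤ σ / b * b := by
            gcongr
            exact hYb k hk x y
        _ = σ := by field_simp
        _ ≤ 1 := hσ1
    · intro k hk x
      have hqk := hq.density (k - 1) x
      have hYx : Measurable (Y k x) := (hY k).comp measurable_prodMk_left
      have hint : Integrable fun y => Y k x y * q (k - 1) x y :=
        hqk.integrable.bdd_mul (c := b) hYx.aestronglyMeasurable (ae_of_all _ fun y => by
          rw [Real.norm_eq_abs, abs_of_nonneg (hY0 k hk x y)]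
          exact hYb k hk x y)
      calc ∫ y, (r * Y k x y) ^ 2 * q (k - 1) x y
          ≤ ∫ y, σ / b * σ * (Y k x y * q (k - 1) x y) := by
            refine integral_mono_of_nonneg (ae_of_all _ fun y =>
              mul_nonneg (sq_nonneg _) (hqk.nonneg y)) (hint.const_mul _) (ae_of_all _ fun y => ?_)
            simp only
            rw [mul_pow, hr2, ← mul_assoc]
            refine mul_le_mul_of_nonneg_right ?_ (hqk.nonneg y)
            have h1 := hY0 k hk x y
            have h2 := hYb k hk x y
            calc σ / b * (σ / b) * Y k x y ^ 2 = σ / b * (σ / b) * (Y k x y * Y k x y) := by ring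
              _ ≤ σ / b * (σ / b) * (b * Y k x y) := by gcongr
              _ = _ := by field_simp
        _ = σ / b * σ * ∫ y, Y k x y * q (k - 1) x y := integral_const_mul _ _
        _ ≤ σ / b * σ * m := by
            gcongr
            exact hm k hk x
  have hσb : 0 < σ / b := div_pos hσ0 hb
  rw [two_mul, ENNReal.ofReal_add (Real.exp_pos _).le (Real.exp_pos _).le]
  refine le_trans (measure_mono ?_) ((measure_union_le _ _).trans
    (add_le_add (hone (σ / b) (abs_of_pos hσb)) (hone (-(σ / b)) (by rw [abs_neg, abs_of_pos hσb]))))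
  intro ω hω
  simp only [Set.mem_ofPred_eq, Set.mem_union] at hω ⊢
  rcases le_abs.1 hω with h | h
  · exact Or.inl (mul_le_mul_of_nonneg_left h hσb.le)
  · refine Or.inr ?_
    rw [neg_mul, ← mul_neg]
    exact mul_le_mul_of_nonneg_left h hσb.le

/-! ### Densities built from kernels -/

section Kernel

variable {d : ℕ} {K : Pt d → ℝ}

theorem IsProbDensity.scaledKernel (hK : IsProbDensity K) {h : ℝ} (hh : 0 < h) :
    IsProbDensity (scaledKernel K h) where
  measurable := (hK.measurable.comp (measurable_const_smul h⁻¹)).div_const _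
  nonneg u := div_nonneg (hK.nonneg _) (pow_pos hh d).le
  integrable := (hK.integrable.comp_smul (inv_ne_zero hh.ne')).div_const _
  integral_eq_one := by
    unfold _root_.scaledKernel
    rw [integral_div, Measure.integral_comp_smul, hK.integral_eq_one]
    have : 0 < h ^ d := pow_pos hh d
    simp only [finrank_euclideanSpace, Fintype.card_fin, inv_pow, inv_inv, smul_eq_mul, mul_one]
    rw [abs_of_pos this, div_self this.ne']

theorem IsProbDensity.comp_sub_right {g : Pt d → ℝ} (hg : IsProbDensity g) (x : Pt d) :
    IsProbDensity fun y => g (y - x) where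
  measurable := hg.measurable.comp (measurable_id.sub_const x)
  nonneg u := hg.nonneg _
  integrable := hg.integrable.comp_sub_right x
  integral_eq_one := by rw [integral_sub_right_eq_self, hg.integral_eq_one]

theorem IsProbDensity.comp_sub_left {g : Pt d → ℝ} (hg : IsProbDensity g) (x : Pt d) :
    IsProbDensity fun y => g (x - y) where
  measurable := hg.measurable.comp (measurable_const.sub measurable_id)
  nonneg u := hg.nonneg _
  integrable := hg.integrable.comp_sub_left x
  integral_eq_one := by rw [integral_sub_left_eq_self, hg.integral_eq_one]

theorem IsProbDensity.sum {ι : Type*} {s : Finset ι} {a : ι → ℝ} {g : ι → Pt d → ℝ}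
    (ha : ∀ i ∈ s, 0 ≤ a i) (ha1 : ∑ i ∈ s, a i = 1) (hg : ∀ i ∈ s, IsProbDensity (g i)) :
    IsProbDensity fun y => ∑ i ∈ s, a i * g i y where
  measurable := Finset.measurable_sum _ fun i hi => (hg i hi).measurable.const_mul _
  nonneg y := Finset.sum_nonneg fun i hi => mul_nonneg (ha i hi) ((hg i hi).nonneg y)
  integrable := integrable_finsetSum _ fun i hi => (hg i hi).integrable.const_mul _
  integral_eq_one := by
    rw [integral_finsetSum _ fun i hi => (hg i hi).integrable.const_mul _, ← ha1]
    refine Finset.sum_congr rfl fun i hi => ?_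
    rw [integral_const_mul, (hg i hi).integral_eq_one, mul_one]

theorem IsProbDensity.mix {g₁ g₂ : Pt d → ℝ} (h₁ : IsProbDensity g₁) (h₂ : IsProbDensity g₂)
    {l : ℝ} (hl0 : 0 ≤ l) (hl1 : l ≤ 1) : IsProbDensity fun y => (1 - l) * g₁ y + l * g₂ y where
  measurable := (h₁.measurable.const_mul _).add (h₂.measurable.const_mul _)
  nonneg y := add_nonneg (mul_nonneg (by linarith) (h₁.nonneg y)) (mul_nonneg hl0 (h₂.nonneg y))
  integrable := (h₁.integrable.const_mul _).add (h₂.integrable.const_mul _)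
  integral_eq_one := by
    rw [integral_add (h₁.integrable.const_mul _) (h₂.integrable.const_mul _), integral_const_mul,
      integral_const_mul, h₁.integral_eq_one, h₂.integral_eq_one]
    ring

theorem abs_scaledKernel_sub_le {LK : NNReal} (hK : LipschitzWith LK K) {h : ℝ} (hh : 0 < h)
    (u v : Pt d) : |scaledKernel K h u - scaledKernel K h v| ≤ LK / h ^ (d + 1) * ‖u - v‖ := by
  have h1 := hK.dist_le_mul (h⁻¹ • u) (h⁻¹ • v)
  rw [Real.dist_eq, dist_eq_norm, ← smul_sub, norm_smul, norm_inv, Real.norm_eq_abs,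
    abs_of_pos hh] at h1
  have hd : 0 < h ^ d := pow_pos hh d
  unfold scaledKernel
  rw [← sub_div, abs_div, abs_of_pos hd, div_le_iff₀ hd]
  refine h1.trans (le_of_eq ?_)
  rw [pow_succ]
  field_simp

theorem normalizedWeight_nonneg {v : ℕ → ℝ} {n : ℕ} (hv : ∀ k ∈ Finset.Icc 1 n, 0 ≤ v k) {k : ℕ}
    (hk : k ∈ Finset.Icc 1 n) : 0 ≤ normalizedWeight v n k := by
  unfold normalizedWeight
  split_ifs
  · positivity
  · exact div_nonneg (hv k hk) (Finset.sum_nonneg hv)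

theorem sum_normalizedWeight (v : ℕ → ℝ) {n : ℕ} (hn : 1 ≤ n) :
    ∑ k ∈ Finset.Icc 1 n, normalizedWeight v n k = 1 := by
  unfold normalizedWeight
  split_ifs with h
  · rw [Finset.sum_const, Nat.card_Icc, nsmul_eq_mul]
    have : (n : ℝ) ≠ 0 := by positivity
    simp [this]
  · rw [← Finset.sum_div, div_self h]

theorem isProbDensity_weightedKDE (hK : IsProbDensity K) {h : ℝ} (hh : 0 < h) (x : ℕ → Pt d)
    {v : ℕ → ℝ} {n : ℕ} (hn : 1 ≤ n) (hv : ∀ k ∈ Finset.Icc 1 n, 0 ≤ v k) :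
    IsProbDensity (weightedKDE K h x v n) :=
  IsProbDensity.sum (fun _ hk => normalizedWeight_nonneg hv hk) (sum_normalizedWeight v hn)
    fun k _ => (hK.scaledKernel hh).comp_sub_right (x k)

theorem scaledKernel_le {Kinf : ℝ} (hK : ∀ u, K u ≤ Kinf) {h : ℝ} (hh : 0 < h) (u : Pt d) :
    scaledKernel K h u ≤ Kinf / h ^ d := by
  unfold scaledKernel
  have := pow_pos hh d
  gcongr
  exact hK _

theorem weightedKDE_le {Kinf : ℝ} (hK : ∀ u, K u ≤ Kinf) {h : ℝ} (hh : 0 < h) (x : ℕ → Pt d)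
    {v : ℕ → ℝ} {n : ℕ} (hn : 1 ≤ n) (hv : ∀ k ∈ Finset.Icc 1 n, 0 ≤ v k) (y : Pt d) :
    weightedKDE K h x v n y ≤ Kinf / h ^ d := by
  calc weightedKDE K h x v n y
      ≤ ∑ k ∈ Finset.Icc 1 n, normalizedWeight v n k * (Kinf / h ^ d) :=
        Finset.sum_le_sum fun k hk => mul_le_mul_of_nonneg_left (scaledKernel_le hK hh _)
          (normalizedWeight_nonneg hv hk)
    _ = Kinf / h ^ d := by rw [← Finset.sum_mul, sum_normalizedWeight v hn, one_mul]

end Kernel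

/-! ### Safe schemes: regularity and two-sided bounds for the proposals -/

/-- The structural assumptions on the sampling scheme, without the rate conditions. -/
structure SafeScheme {d : ℕ} (f q₀ K : Pt d → ℝ) (lam h eta : ℕ → ℝ) (c U U₀ Kinf : ℝ) :
    Prop where
  target : IsProbDensity f
  safe : IsProbDensity q₀
  kernel : IsProbDensity K
  lam_mem : ∀ k, 1 ≤ k → lam k ∈ Set.Ioc (0 : ℝ) 1
  lam_anti : AntitoneOn lam (Set.Ici 1)
  h_pos : ∀ k, 1 ≤ k → 0 < h k
  h_anti : AntitoneOn h (Set.Ici 1)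
  eta_mem : ∀ k, 1 ≤ k → eta k ∈ Set.Ioc (0 : ℝ) 1
  c_pos : 0 < c
  mul_target_le : ∀ x, c * f x ≤ q₀ x
  target_le : ∀ x, f x ≤ U
  safe_le : ∀ x, q₀ x ≤ U₀
  kernel_le : ∀ x, K x ≤ Kinf

/-- The mixture weight of the safe density in the `k`-th draw: `1` for the first draw and
`lam (k - 1)` afterwards. -/
noncomputable def drawMixture (lam : ℕ → ℝ) (k : ℕ) : ℝ := if k = 1 then 1 else lam (k - 1)

namespace SafeScheme

variable {d : ℕ} {f q₀ K : Pt d → ℝ} {lam h eta : ℕ → ℝ} {c U U₀ Kinf : ℝ}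

/-- Strong induction is needed because the weights at time `k` divide by all earlier proposals,
whose nonnegativity makes the weights nonnegative. -/
theorem isProbDensity_proposal (H : SafeScheme f q₀ K lam h eta c U U₀ Kinf) (k : ℕ)
    (x : ℕ → Pt d) : IsProbDensity (proposal f q₀ K lam h eta x k) := by
  induction k using Nat.strong_induction_on with
  | _ k ih =>
    rcases Nat.eq_zero_or_pos k with rfl | hk
    · rw [proposal_zero]
      exact H.safe
    · have h1 : IsProbDensity (targetEstimate f q₀ K lam h eta x k) := by
        refine isProbDensity_weightedKDE H.kernel (H.h_pos k hk) x hk fun j hj => ?_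
        rw [Finset.mem_Icc] at hj
        exact Real.rpow_nonneg (div_nonneg (H.target.nonneg _)
          ((ih (j - 1) (by omega)).nonneg _)) _
      have h2 := h1.mix H.safe (H.lam_mem k hk).1.le (H.lam_mem k hk).2
      rw [funext (proposal_of_one_le f q₀ K lam h eta x k hk)]
      exact h2

theorem importanceWeight_nonneg (H : SafeScheme f q₀ K lam h eta c U U₀ Kinf) (k : ℕ)
    (x : ℕ → Pt d) : 0 ≤ importanceWeight f q₀ K lam h eta x k :=
  div_nonneg (H.target.nonneg _) ((H.isProbDensity_proposal _ x).nonneg _)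

theorem measurable_weightedKDE (H : SafeScheme f q₀ K lam h eta c U U₀ Kinf) (b : ℝ)
    {v : ℕ → (ℕ → Pt d) → ℝ} {n : ℕ} (hv : ∀ k ∈ Finset.Icc 1 n, Measurable (v k)) :
    Measurable fun p : (ℕ → Pt d) × Pt d => weightedKDE K b p.1 (fun k => v k p.1) n p.2 := by
  unfold weightedKDE
  refine Finset.measurable_sum _ fun k hk => Measurable.mul ?_ ?_
  · unfold normalizedWeight
    have hs : Measurable fun p : (ℕ → Pt d) × Pt d => ∑ j ∈ Finset.Icc 1 n, v j p.1 :=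
      Finset.measurable_sum _ fun j hj => (hv j hj).comp measurable_fst
    exact Measurable.ite (hs (measurableSet_singleton 0)) measurable_const
      (((hv k hk).comp measurable_fst).div hs)
  · unfold scaledKernel
    refine (H.kernel.measurable.comp ?_).div_const _
    have hx : Measurable fun p : (ℕ → Pt d) × Pt d => p.1 k :=
      (measurable_pi_apply k).comp measurable_fst
    exact (measurable_snd.sub hx).const_smul b⁻¹

theorem measurable_proposal (H : SafeScheme f q₀ K lam h eta c U U₀ Kinf) (k : ℕ) :
    Measurable (Function.uncurry fun x => proposal f q₀ K lam h eta x k) := by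
  induction k using Nat.strong_induction_on with
  | _ k ih =>
    rcases Nat.eq_zero_or_pos k with rfl | hk
    · simp only [proposal_zero]
      exact H.safe.measurable.comp measurable_snd
    · have h1 : Measurable fun p : (ℕ → Pt d) × Pt d =>
          targetEstimate f q₀ K lam h eta p.1 k p.2 := by
        refine H.measurable_weightedKDE (h k)
          (v := fun j x => importanceWeight f q₀ K lam h eta x j ^ eta j) fun j hj => ?_
        rw [Finset.mem_Icc] at hj
        refine Measurable.pow_const ?_ _
        refine (H.target.measurable.comp (measurable_pi_apply j)).div ?_
        exact (ih (j - 1) (by omega)).comp (measurable_id.prodMk (measurable_pi_apply j))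
      have h2 : (Function.uncurry fun x => proposal f q₀ K lam h eta x k) =
          fun p : (ℕ → Pt d) × Pt d => (1 - lam k) * targetEstimate f q₀ K lam h eta p.1 k p.2 +
            lam k * q₀ p.2 := by
        funext p
        exact proposal_of_one_le f q₀ K lam h eta p.1 k hk p.2
      rw [h2]
      exact (h1.const_mul _).add ((H.safe.measurable.comp measurable_snd).const_mul _)

theorem _root_.proposal_congr (f q₀ K : Pt d → ℝ) (lam h eta : ℕ → ℝ) {x x' : ℕ → Pt d} {k : ℕ}
    (hx : ∀ j ∈ Finset.Icc 1 k, x j = x' j) :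
    proposal f q₀ K lam h eta x k = proposal f q₀ K lam h eta x' k := by
  induction k using Nat.strong_induction_on with
  | _ k ih =>
    rcases Nat.eq_zero_or_pos k with rfl | hk
    · rw [proposal_zero, proposal_zero]
    · funext y
      rw [proposal_of_one_le _ _ _ _ _ _ _ _ hk, proposal_of_one_le _ _ _ _ _ _ _ _ hk]
      have hw : ∀ j ∈ Finset.Icc 1 k, importanceWeight f q₀ K lam h eta x j ^ eta j =
          importanceWeight f q₀ K lam h eta x' j ^ eta j := by
        intro j hj
        have hj' := Finset.mem_Icc.1 hj
        unfold importanceWeight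
        rw [hx j hj, ih (j - 1) (by omega) fun i hi => hx i (Finset.mem_Icc.2 ⟨
          (Finset.mem_Icc.1 hi).1, by have := (Finset.mem_Icc.1 hi).2; omega⟩)]
      unfold targetEstimate
      rw [weightedKDE_congr K (h k) x _ _ k hw]
      unfold weightedKDE
      rw [Finset.sum_congr rfl fun j hj => by rw [hx j hj]]

theorem isPolicyDensity (H : SafeScheme f q₀ K lam h eta c U U₀ Kinf) :
    IsPolicyDensity fun k x => proposal f q₀ K lam h eta x k where
  measurable := H.measurable_proposal
  density := H.isProbDensity_proposal
  pathTrunc_eq _ x := proposal_congr f q₀ K lam h eta fun _ hj => pathTrunc_apply_of_mem hj x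

theorem drawMixture_pos (H : SafeScheme f q₀ K lam h eta c U U₀ Kinf) {k : ℕ} (hk : 1 ≤ k) :
    0 < drawMixture lam k := by
  unfold drawMixture
  split_ifs with h1
  · exact one_pos
  · exact (H.lam_mem (k - 1) (by omega)).1

theorem lam_le_drawMixture (H : SafeScheme f q₀ K lam h eta c U U₀ Kinf) {k n : ℕ}
    (hk : k ∈ Finset.Icc 1 n) : lam n ≤ drawMixture lam k := by
  rw [Finset.mem_Icc] at hk
  unfold drawMixture
  split_ifs with h1
  · exact (H.lam_mem n (by omega)).2
  · exact H.lam_anti (Set.mem_Ici.2 (by omega)) (Set.mem_Ici.2 (by omega)) (by omega)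

/-- Safety: the proposal dominates a multiple of the target. -/
theorem mul_target_le_proposal (H : SafeScheme f q₀ K lam h eta c U U₀ Kinf) {k : ℕ} (hk : 1 ≤ k)
    (x : ℕ → Pt d) (y : Pt d) :
    c * drawMixture lam k * f y ≤ proposal f q₀ K lam h eta x (k - 1) y := by
  unfold drawMixture
  split_ifs with h1
  · subst h1
    rw [proposal_zero, mul_one]
    exact H.mul_target_le y
  · have hk1 : 1 ≤ k - 1 := by omega
    rw [proposal_of_one_le _ _ _ _ _ _ _ _ hk1]
    have h2 : 0 ≤ targetEstimate f q₀ K lam h eta x (k - 1) y :=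
      (isProbDensity_weightedKDE H.kernel (H.h_pos _ hk1) x hk1 fun j _ =>
        Real.rpow_nonneg (H.importanceWeight_nonneg j x) _).nonneg y
    have h3 := H.lam_mem _ hk1
    have h4 := mul_nonneg (sub_nonneg.2 h3.2) h2
    have h5 := mul_le_mul_of_nonneg_left (H.mul_target_le y) h3.1.le
    linarith

theorem kernelBound_nonneg (H : SafeScheme f q₀ K lam h eta c U U₀ Kinf) : 0 ≤ Kinf :=
  (H.kernel.nonneg 0).trans (H.kernel_le 0)

theorem targetBound_nonneg (H : SafeScheme f q₀ K lam h eta c U U₀ Kinf) : 0 ≤ U :=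
  (H.target.nonneg 0).trans (H.target_le 0)

theorem safeBound_nonneg (H : SafeScheme f q₀ K lam h eta c U U₀ Kinf) : 0 ≤ U₀ :=
  (H.safe.nonneg 0).trans (H.safe_le 0)

/-- A kernel estimate is at most `Kinf` over the bandwidth to the power `d`, and bandwidths
decrease; `h k ≤ h 1` puts the bound on `q₀` into the same form. The summand `1` only serves to make
the constant positive, so that its logarithm can be used. -/
theorem proposal_le (H : SafeScheme f q₀ K lam h eta c U U₀ Kinf) {k : ℕ} (hk : 1 ≤ k)
    (x : ℕ → Pt d) (y : Pt d) :
    proposal f q₀ K lam h eta x (k - 1) y ≤ (1 + Kinf + U₀ * h 1 ^ d) / h k ^ d := by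
  have hhk := H.h_pos k hk
  have hpow : 0 < h k ^ d := pow_pos hhk d
  have hK0 := H.kernelBound_nonneg
  have hU0 := H.safeBound_nonneg
  have hh1 : h k ≤ h 1 := H.h_anti (Set.mem_Ici.2 le_rfl) (Set.mem_Ici.2 hk) hk
  have hq0 : q₀ y ≤ U₀ * h 1 ^ d / h k ^ d := by
    rw [le_div_iff₀ hpow]
    calc q₀ y * h k ^ d ≤ U₀ * h k ^ d := by
          gcongr
          exact H.safe_le y
      _ ≤ U₀ * h 1 ^ d := by gcongr
  have hsplit : (1 + Kinf + U₀ * h 1 ^ d) / h k ^ d =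
      1 / h k ^ d + Kinf / h k ^ d + U₀ * h 1 ^ d / h k ^ d := by rw [add_div, add_div]
  have hpos1 : 0 ≤ 1 / h k ^ d := by positivity
  have hpos2 : 0 ≤ Kinf / h k ^ d := by positivity
  rcases Nat.lt_or_ge k 2 with h1 | h1
  · obtain rfl : k = 1 := by omega
    rw [proposal_zero]
    linarith
  · have hk1 : 1 ≤ k - 1 := by omega
    rw [proposal_of_one_le _ _ _ _ _ _ _ _ hk1]
    have h2 : targetEstimate f q₀ K lam h eta x (k - 1) y ≤ Kinf / h k ^ d := by
      refine (weightedKDE_le H.kernel_le (H.h_pos _ hk1) x hk1 (fun j _ =>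
        Real.rpow_nonneg (H.importanceWeight_nonneg j x) _) y).trans ?_
      have : h k ≤ h (k - 1) := H.h_anti (Set.mem_Ici.2 hk1) (Set.mem_Ici.2 hk) (by omega)
      gcongr
    have h3 := H.lam_mem _ hk1
    have h4 := mul_le_mul_of_nonneg_left h2 (sub_nonneg.2 h3.2)
    have h5 := mul_le_mul_of_nonneg_left hq0 h3.1.le
    have h6 : 0 ≤ U₀ * h 1 ^ d / h k ^ d := (H.safe.nonneg y).trans hq0
    have h7 := mul_nonneg h3.1.le hpos2
    have h8 := mul_nonneg (sub_nonneg.2 h3.2) h6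
    linarith

end SafeScheme

/-! ### Scalar inequalities for regularized weights -/

section Scalar

variable {a q η : ℝ}

theorem div_rpow_mul_eq (ha : 0 ≤ a) (hq : 0 < q) : (a / q) ^ η * q = a ^ η * q ^ (1 - η) := by
  rw [Real.div_rpow ha hq.le, Real.rpow_sub hq, Real.rpow_one]
  ring

theorem div_rpow_mul_nonneg (ha : 0 ≤ a) (hq : 0 ≤ q) : 0 ≤ (a / q) ^ η * q :=
  mul_nonneg (Real.rpow_nonneg (div_nonneg ha hq) _) hq

/-- Weighted arithmetic-geometric mean inequality for `a ^ η * q ^ (1 - η)`. At `q = 0` the left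
side vanishes because of the factor `q`. -/
theorem div_rpow_mul_le_mix (ha : 0 ≤ a) (hq : 0 ≤ q) (hη : η ∈ Set.Ioc (0 : ℝ) 1) :
    (a / q) ^ η * q ≤ η * a + (1 - η) * q := by
  rcases hq.eq_or_lt with rfl | hq'
  · simpa using mul_nonneg hη.1.le ha
  · rw [div_rpow_mul_eq ha hq']
    exact Real.geom_mean_le_arith_mean2_weighted hη.1.le (sub_nonneg.2 hη.2) ha hq (by ring)

theorem div_rpow_mul_le (ha : 0 ≤ a) (hq : 0 ≤ q) (hη : η ∈ Set.Ioc (0 : ℝ) 1) {Q : ℝ}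
    (hqQ : q ≤ Q) : (a / q) ^ η * q ≤ Q ^ (1 - η) * (a + (1 - η)) := by
  have hη1 : 0 ≤ 1 - η := sub_nonneg.2 hη.2
  rcases hq.eq_or_lt with rfl | hq'
  · simpa using mul_nonneg (Real.rpow_nonneg hqQ _) (add_nonneg ha hη1)
  · rw [div_rpow_mul_eq ha hq', mul_comm]
    have h1 : a ^ η ≤ a + (1 - η) := by
      have := Real.geom_mean_le_arith_mean2_weighted hη.1.le hη1 ha zero_le_one (by ring)
      rw [Real.one_rpow, mul_one, mul_one] at this
      nlinarith [mul_nonneg hη1 ha]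
    exact mul_le_mul (Real.rpow_le_rpow hq hqQ hη1) h1 (Real.rpow_nonneg ha _)
      (Real.rpow_nonneg (hq.trans hqQ) _)

/-- Replacing `q` by its lower bound `l * a` in `a ^ η * q ^ (1 - η)` recombines the two powers of
`a`. -/
theorem rpow_mul_le_div_rpow_mul (ha : 0 ≤ a) (hq : 0 ≤ q) (hη : η ∈ Set.Ioc (0 : ℝ) 1) {l : ℝ}
    (hl : 0 < l) (hlq : l * a ≤ q) : l ^ (1 - η) * a ≤ (a / q) ^ η * q := by
  rcases ha.eq_or_lt with rfl | ha'
  · simpa using div_rpow_mul_nonneg (η := η) le_rfl hq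
  · have hq' : 0 < q := (mul_pos hl ha').trans_le hlq
    rw [div_rpow_mul_eq ha hq']
    calc l ^ (1 - η) * a = a ^ η * (l * a) ^ (1 - η) := by
          rw [Real.mul_rpow hl.le ha, mul_left_comm, ← Real.rpow_add ha']
          simp
      _ ≤ a ^ η * q ^ (1 - η) := by
          have := Real.rpow_le_rpow (mul_nonneg hl.le ha) hlq (sub_nonneg.2 hη.2)
          gcongr

theorem div_rpow_le_of_mul_le (ha : 0 ≤ a) (hq : 0 ≤ q) (hη : η ∈ Set.Ioc (0 : ℝ) 1) {l M : ℝ}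
    (hl : 0 < l) (hlq : l * a ≤ q) (hM : 1 ≤ M) (hlM : 1 / l ≤ M) : (a / q) ^ η ≤ M := by
  -- The bound `M ≥ 1` allows the exponent `η ≤ 1` to be dropped afterwards.
  have h1 : a / q ≤ M := by
    refine le_trans ?_ hlM
    rcases hq.eq_or_lt with rfl | hq'
    · simpa using hl.le
    · rw [div_le_div_iff₀ hq' hl]
      linarith
  calc (a / q) ^ η ≤ M ^ η := Real.rpow_le_rpow (div_nonneg ha hq) h1 hη.1.le
    _ ≤ M ^ (1 : ℝ) := Real.rpow_le_rpow_of_exponent_le hM hη.2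
    _ = M := Real.rpow_one M

end Scalar

/-! ### The tilted target: closeness to the target and concentration -/

/-- The conditional density of the `k`-th draw multiplied by its regularized weight. -/
noncomputable def tiltedTarget {d : ℕ} (f q₀ K : Pt d → ℝ) (lam h eta : ℕ → ℝ) (k : ℕ)
    (x : ℕ → Pt d) (y : Pt d) : ℝ :=
  (f y / proposal f q₀ K lam h eta x (k - 1) y) ^ eta k * proposal f q₀ K lam h eta x (k - 1) y

/-- Upper bound for the distance between `tiltedTarget` and the target. -/
noncomputable def tiltError (d : ℕ) (lam h eta : ℕ → ℝ) (c U A : ℝ) (k : ℕ) : ℝ :=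
  |(c * drawMixture lam k) ^ (1 - eta k) - 1| * U + |(A / h k ^ d) ^ (1 - eta k) - 1| * U +
    (A / h k ^ d) ^ (1 - eta k) * (1 - eta k)

theorem tendsto_rpow_one_sub {a eta : ℕ → ℝ} (ha : ∀ᶠ k in atTop, 0 < a k)
    (hlim : Tendsto (fun k => (1 - eta k) * Real.log (a k)) atTop (𝓝 0)) :
    Tendsto (fun k => a k ^ (1 - eta k)) atTop (𝓝 1) := by
  have h1 : Tendsto (fun k => Real.exp ((1 - eta k) * Real.log (a k))) atTop (𝓝 1) := by
    have := (Real.continuous_exp.tendsto 0).comp hlim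
    rwa [Real.exp_zero] at this
  refine h1.congr' ?_
  filter_upwards [ha] with k hk
  rw [Real.rpow_def_of_pos hk, mul_comm]

namespace SafeScheme

variable {d : ℕ} {f q₀ K : Pt d → ℝ} {lam h eta : ℕ → ℝ} {c U U₀ Kinf : ℝ}

theorem tiltedTarget_nonneg (H : SafeScheme f q₀ K lam h eta c U U₀ Kinf) (k : ℕ)
    (x : ℕ → Pt d) (y : Pt d) : 0 ≤ tiltedTarget f q₀ K lam h eta k x y :=
  div_rpow_mul_nonneg (H.target.nonneg y) ((H.isProbDensity_proposal _ x).nonneg y)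

theorem measurable_tiltedTarget (H : SafeScheme f q₀ K lam h eta c U U₀ Kinf) (k : ℕ)
    (x : ℕ → Pt d) : Measurable (tiltedTarget f q₀ K lam h eta k x) :=
  ((H.target.measurable.div (H.isProbDensity_proposal _ x).measurable).pow_const _).mul
    (H.isProbDensity_proposal _ x).measurable

theorem integrable_tiltedTarget (H : SafeScheme f q₀ K lam h eta c U U₀ Kinf) {k : ℕ} (hk : 1 ≤ k)
    (x : ℕ → Pt d) : Integrable (tiltedTarget f q₀ K lam h eta k x) := by
  have hq := H.isProbDensity_proposal (k - 1) x
  refine Integrable.mono' ((H.target.integrable.const_mul (eta k)).add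
    (hq.integrable.const_mul (1 - eta k)))
    (H.measurable_tiltedTarget k x).aestronglyMeasurable (ae_of_all _ fun y => ?_)
  rw [Real.norm_eq_abs, abs_of_nonneg (H.tiltedTarget_nonneg k x y)]
  exact div_rpow_mul_le_mix (H.target.nonneg y) (hq.nonneg y) (H.eta_mem k hk)

/-- The tilted target lies below the mixture `eta k * f + (1 - eta k) * q_{k-1}` of two probability
densities. -/
theorem integral_tiltedTarget_le_one (H : SafeScheme f q₀ K lam h eta c U U₀ Kinf) {k : ℕ}
    (hk : 1 ≤ k) (x : ℕ → Pt d) : ∫ y, tiltedTarget f q₀ K lam h eta k x y ≤ 1 := by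
  have hq := H.isProbDensity_proposal (k - 1) x
  calc ∫ y, tiltedTarget f q₀ K lam h eta k x y
      ≤ ∫ y, (eta k * f y + (1 - eta k) * proposal f q₀ K lam h eta x (k - 1) y) :=
        integral_mono (H.integrable_tiltedTarget hk x) ((H.target.integrable.const_mul _).add
          (hq.integrable.const_mul _)) fun y =>
          div_rpow_mul_le_mix (H.target.nonneg y) (hq.nonneg y) (H.eta_mem k hk)
    _ = 1 := by
        rw [integral_add (H.target.integrable.const_mul _) (hq.integrable.const_mul _),
          integral_const_mul, integral_const_mul, H.target.integral_eq_one, hq.integral_eq_one]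
        ring

theorem rpow_mul_target_le_tiltedTarget (H : SafeScheme f q₀ K lam h eta c U U₀ Kinf) {k : ℕ}
    (hk : 1 ≤ k) (x : ℕ → Pt d) (y : Pt d) :
    (c * drawMixture lam k) ^ (1 - eta k) * f y ≤ tiltedTarget f q₀ K lam h eta k x y :=
  rpow_mul_le_div_rpow_mul (H.target.nonneg y) ((H.isProbDensity_proposal _ x).nonneg y)
    (H.eta_mem k hk) (mul_pos H.c_pos (H.drawMixture_pos hk)) (H.mul_target_le_proposal hk x y)

theorem rpow_le_integral_tiltedTarget (H : SafeScheme f q₀ K lam h eta c U U₀ Kinf) {k : ℕ}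
    (hk : 1 ≤ k) (x : ℕ → Pt d) :
    (c * drawMixture lam k) ^ (1 - eta k) ≤ ∫ y, tiltedTarget f q₀ K lam h eta k x y := by
  have h1 := integral_mono (H.target.integrable.const_mul ((c * drawMixture lam k) ^ (1 - eta k)))
    (H.integrable_tiltedTarget hk x) (H.rpow_mul_target_le_tiltedTarget hk x)
  rwa [integral_const_mul, H.target.integral_eq_one, mul_one] at h1

/-- The proposal enters only through its a priori lower and upper bounds, so the error is
deterministic: uniform in the path and in the point. -/
theorem abs_tiltedTarget_sub_le (H : SafeScheme f q₀ K lam h eta c U U₀ Kinf) {k : ℕ}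
    (hk : 1 ≤ k) (x : ℕ → Pt d) (y : Pt d) :
    |tiltedTarget f q₀ K lam h eta k x y - f y| ≤
      tiltError d lam h eta c U (1 + Kinf + U₀ * h 1 ^ d) k := by
  set A := 1 + Kinf + U₀ * h 1 ^ d with hA
  have hf0 := H.target.nonneg y
  have hfU := H.target_le y
  have hη := H.eta_mem k hk
  have hη1 : 0 ≤ 1 - eta k := sub_nonneg.2 hη.2
  have hAh : 0 ≤ A / h k ^ d :=
    ((H.isProbDensity_proposal (k - 1) x).nonneg y).trans (H.proposal_le hk x y)
  have hlow := H.rpow_mul_target_le_tiltedTarget hk x y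
  have hup : tiltedTarget f q₀ K lam h eta k x y ≤
      (A / h k ^ d) ^ (1 - eta k) * (f y + (1 - eta k)) :=
    div_rpow_mul_le hf0 ((H.isProbDensity_proposal _ x).nonneg y) hη (H.proposal_le hk x y)
  unfold tiltError
  set l := (c * drawMixture lam k) ^ (1 - eta k)
  set Q := (A / h k ^ d) ^ (1 - eta k) with hQ
  have hQ0 : 0 ≤ Q := Real.rpow_nonneg hAh _
  have h1 : |(l - 1) * f y| ≤ |l - 1| * U := by
    rw [abs_mul, abs_of_nonneg hf0]
    gcongr
  have h2 : |(Q - 1) * f y| ≤ |Q - 1| * U := by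
    rw [abs_mul, abs_of_nonneg hf0]
    gcongr
  have h3 := mul_nonneg hQ0 hη1
  have h4 := (abs_nonneg _).trans h1
  have h5 := (abs_nonneg _).trans h2
  rw [abs_le]
  constructor
  · linarith [(abs_le.1 h1).1]
  · linarith [(abs_le.1 h2).2]

theorem tendsto_mul_log_mixture (H : SafeScheme f q₀ K lam h eta c U U₀ Kinf)
    (heta : Tendsto eta atTop (𝓝 1))
    (hlam : Tendsto (fun k : ℕ => (1 - eta k) * Real.log (lam (k - 1))) atTop (𝓝 0)) :
    Tendsto (fun k => (c * drawMixture lam k) ^ (1 - eta k)) atTop (𝓝 1) := by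
  have hpos : ∀ᶠ k in atTop, 0 < c * drawMixture lam k :=
    (eventually_ge_atTop 1).mono fun k hk => mul_pos H.c_pos (H.drawMixture_pos hk)
  refine tendsto_rpow_one_sub hpos ?_
  have h1 : Tendsto (fun k => (1 - eta k) * Real.log c + (1 - eta k) * Real.log (lam (k - 1)))
      atTop (𝓝 0) := by
    have := (((tendsto_const_nhds (x := (1 : ℝ))).sub heta).mul_const (Real.log c)).add hlam
    simpa using this
  refine h1.congr' ?_
  -- At `k = 1` the formula would involve `lam 0`, which is unconstrained.
  filter_upwards [eventually_ge_atTop 2] with k hk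
  have h2 : drawMixture lam k = lam (k - 1) := by
    unfold drawMixture
    rw [if_neg (by omega)]
  rw [h2, Real.log_mul H.c_pos.ne' (H.lam_mem (k - 1) (by omega)).1.ne']
  ring

theorem tendsto_tiltError (H : SafeScheme f q₀ K lam h eta c U U₀ Kinf)
    (heta : Tendsto eta atTop (𝓝 1))
    (hh : Tendsto (fun k : ℕ => (1 - eta k) * Real.log (h k)) atTop (𝓝 0))
    (hlam : Tendsto (fun k : ℕ => (1 - eta k) * Real.log (lam (k - 1))) atTop (𝓝 0))
    {A : ℝ} (hA : 0 < A) : Tendsto (tiltError d lam h eta c U A) atTop (𝓝 0) := by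
  have hη : Tendsto (fun k => 1 - eta k) atTop (𝓝 0) := by
    simpa using (tendsto_const_nhds (x := (1 : ℝ))).sub heta
  have h1 := H.tendsto_mul_log_mixture heta hlam
  have h2 : Tendsto (fun k => (A / h k ^ d) ^ (1 - eta k)) atTop (𝓝 1) := by
    refine tendsto_rpow_one_sub ((eventually_ge_atTop 1).mono fun k hk =>
      div_pos hA (pow_pos (H.h_pos k hk) d)) ?_
    have h3 : Tendsto (fun k => (1 - eta k) * Real.log A -
        d * ((1 - eta k) * Real.log (h k))) atTop (𝓝 0) := by
      simpa using (hη.mul_const (Real.log A)).sub (hh.const_mul (d : ℝ))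
    refine h3.congr' ?_
    filter_upwards [eventually_ge_atTop 1] with k hk
    rw [Real.log_div hA.ne' (pow_pos (H.h_pos k hk) d).ne', Real.log_pow]
    ring
  have h4 := ((((h1.sub_const 1).abs.mul_const U).add ((h2.sub_const 1).abs.mul_const U)).add
    (h2.mul hη))
  unfold tiltError
  simpa using h4

theorem proposalBound_pos (H : SafeScheme f q₀ K lam h eta c U U₀ Kinf) :
    0 < 1 + Kinf + U₀ * h 1 ^ d := by
  have h1 := H.kernelBound_nonneg
  have h2 := mul_nonneg H.safeBound_nonneg (pow_pos (H.h_pos 1 le_rfl) d).le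
  linarith

/-- Regularized importance weights are at most of the order of `1 / lam n`. -/
theorem div_rpow_le (H : SafeScheme f q₀ K lam h eta c U U₀ Kinf) {k n : ℕ}
    (hk : k ∈ Finset.Icc 1 n) (x : ℕ → Pt d) (y : Pt d) :
    (f y / proposal f q₀ K lam h eta x (k - 1) y) ^ eta k ≤ (1 + 1 / c) / lam n := by
  have hk' := Finset.mem_Icc.1 hk
  have hlam := H.lam_mem n (by omega)
  have hc := H.c_pos
  have hdm := H.lam_le_drawMixture hk
  refine div_rpow_le_of_mul_le (H.target.nonneg y) ((H.isProbDensity_proposal _ x).nonneg y)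
    (H.eta_mem k hk'.1) (mul_pos hc (H.drawMixture_pos hk'.1))
    (H.mul_target_le_proposal hk'.1 x y) ?_ ?_
  · rw [le_div_iff₀ hlam.1, one_mul]
    have : 0 < 1 / c := by positivity
    linarith [hlam.2]
  · have h1 : 1 / (c * drawMixture lam k) ≤ 1 / c / lam n := by
      rw [div_div]
      exact one_div_le_one_div_of_le (mul_pos hc hlam.1) (mul_le_mul_of_nonneg_left hdm hc.le)
    refine h1.trans (div_le_div_of_nonneg_right (by linarith) hlam.1.le)

/-- Concentration of weighted sums over the particles around their compensators. -/
theorem exists_measure_abs_weighted_sum_sub_ge_le {Ω : Type*} [MeasurableSpace Ω] {P : Measure Ω}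
    [IsProbabilityMeasure P] {X : ℕ → Ω → Pt d}
    (H : SafeScheme f q₀ K lam h eta c U U₀ Kinf)
    (hX : HasPolicy P X fun k ω => proposal f q₀ K lam h eta (fun j => X j ω) k)
    {m t : ℝ} (hm : 0 < m) (ht : 0 < t) :
    ∃ κ : ℝ, 0 < κ ∧ ∀ n, 1 ≤ n → ∀ B : ℝ, 0 < B → ∀ g : Pt d → ℝ, Measurable g →
      (∀ y, 0 ≤ g y) → (∀ y, g y ≤ B) →
      (∀ k, 1 ≤ k → ∀ x, ∫ y, tiltedTarget f q₀ K lam h eta k x y * g y ≤ m) →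
      P {ω | n * t ≤ |∑ k ∈ Finset.Icc 1 n,
        (importanceWeight f q₀ K lam h eta (fun j => X j ω) k ^ eta k * g (X k ω) -
          ∫ y, tiltedTarget f q₀ K lam h eta k (fun j => X j ω) y * g y)|} ≤
        ENNReal.ofReal (2 * Real.exp (-(κ * (n * lam n / B)))) := by
  have hc := H.c_pos
  -- This gives `t - σ * m ≥ t / 2`, with `σ ≤ 1` as the Chernoff bound requires. The resulting `κ`
  -- depends on `m`, `t` and `c` only, hence is uniform in `n`, `B` and `g`.
  set σ := min 1 (t / (2 * m)) with hσ
  have hσ0 : 0 < σ := lt_min one_pos (by positivity)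
  have hσm : σ * m ≤ t / 2 := by
    calc σ * m ≤ t / (2 * m) * m := by gcongr; exact min_le_right _ _
      _ = t / 2 := by field_simp
  refine ⟨σ * (t / 2) / (1 + 1 / c), by positivity, ?_⟩
  intro n hn B hB g hg hg0 hgB hgm
  have hlam := H.lam_mem n hn
  have hM : 0 < (1 + 1 / c) / lam n := div_pos (by positivity) hlam.1
  have hident : ∀ k x y, (f y / proposal f q₀ K lam h eta x (k - 1) y) ^ eta k * g y *
      proposal f q₀ K lam h eta x (k - 1) y = tiltedTarget f q₀ K lam h eta k x y * g y := by
    intro k x y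
    unfold tiltedTarget
    ring
  have hw0 : ∀ k x y, 0 ≤ (f y / proposal f q₀ K lam h eta x (k - 1) y) ^ eta k :=
    fun k x y => Real.rpow_nonneg (div_nonneg (H.target.nonneg y)
      ((H.isProbDensity_proposal _ x).nonneg y)) _
  have hmain := measure_abs_sum_sub_mean_ge_le (q := fun k x => proposal f q₀ K lam h eta x k)
    H.isPolicyDensity hX
    (Y := fun k x y => (f y / proposal f q₀ K lam h eta x (k - 1) y) ^ eta k * g y)
    (fun k => (((H.target.measurable.comp measurable_snd).div
      (H.measurable_proposal (k - 1))).pow_const _).mul (hg.comp measurable_snd))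
    (fun k x => by
      have := H.isPolicyDensity.pathTrunc_eq k x
      simp only [Nat.add_sub_cancel, this])
    (n := n) (b := (1 + 1 / c) / lam n * B) (m := m) (t := t) (mul_pos hM hB)
    (fun k _ x y => mul_nonneg (hw0 k x y) (hg0 y))
    (fun k hk x y => mul_le_mul (H.div_rpow_le hk x y) (hgB y) (hg0 y) hM.le)
    (fun k hk x => by
      simp only [hident]
      exact hgm k (Finset.mem_Icc.1 hk).1 x) hσ0 (min_le_left _ _)
  simp only [hident] at hmain
  refine hmain.trans (ENNReal.ofReal_le_ofReal ?_)
  refine mul_le_mul_of_nonneg_left (Real.exp_le_exp.2 (neg_le_neg ?_)) zero_le_two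
  calc σ * (t / 2) / (1 + 1 / c) * (n * lam n / B)
      = n / ((1 + 1 / c) / lam n * B) * (σ * (t / 2)) := by
        have := hlam.1.ne'
        field_simp
    _ ≤ n / ((1 + 1 / c) / lam n * B) * (σ * (t - σ * m)) := by
        gcongr
        linarith

end SafeScheme

/-! ### Borel–Cantelli, polynomial nets and Cesàro means -/

/-- Borel–Cantelli for events whose probabilities are eventually dominated by `C / n ^ 2`. -/
theorem ae_eventually_notMem_of_le_div_sq {Ω : Type*} [MeasurableSpace Ω] {P : Measure Ω}
    {A : ℕ → Set Ω} {C : ℝ}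
    (hA : ∀ᶠ n : ℕ in atTop, P (A n) ≤ ENNReal.ofReal (C / (n : ℝ) ^ 2)) :
    ∀ᵐ ω ∂P, ∀ᶠ n in atTop, ω ∉ A n := by
  obtain ⟨N, hN⟩ := eventually_atTop.1 hA
  let A' : ℕ → Set Ω := fun n => if N ≤ n then A n else ∅
  have hle : ∀ n, P (A' n) ≤ ENNReal.ofReal (C / (n : ℝ) ^ 2) := by
    intro n
    by_cases hn : N ≤ n
    · simpa only [A', hn, if_true] using hN n hn
    · simp only [A', hn, if_false, measure_empty]
      exact zero_le
  have hsum : Summable fun n : ℕ => C / (n : ℝ) ^ 2 := by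
    simpa [div_eq_mul_inv] using
      ((Real.summable_nat_pow_inv (p := 2)).2 one_lt_two).mul_left C
  have hfin : ∑' n, P (A' n) ≠ ⊤ :=
    ne_top_of_le_ne_top hsum.tsum_ofReal_ne_top (ENNReal.tsum_le_tsum hle)
  filter_upwards [ae_eventually_notMem hfin] with ω hω
  filter_upwards [hω, eventually_ge_atTop N] with n hn hNn
  simpa only [A', hNn, if_true] using hn

theorem eventually_exp_neg_mul_le_inv_pow {a : ℕ → ℝ} (ha : ∀ᶠ n in atTop, 0 < a n)
    (hlim : Tendsto (fun n : ℕ => Real.log n / a n) atTop (𝓝 0)) {κ : ℝ} (hκ : 0 < κ) (p : ℕ) :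
    ∀ᶠ n : ℕ in atTop, Real.exp (-(κ * a n)) ≤ ((n : ℝ) ^ p)⁻¹ := by
  -- Then `κ * a n` exceeds `(p + 1) * log n`; using `p + 1` also covers `p = 0`.
  have h1 : ∀ᶠ n : ℕ in atTop, Real.log n / a n < κ / (p + 1) :=
    hlim.eventually_lt_const (by positivity)
  filter_upwards [ha, h1, eventually_ge_atTop 1] with n hn hlt hn1
  have hn0 : (0 : ℝ) < n := by exact_mod_cast hn1
  have hlog : 0 ≤ Real.log n := Real.log_nonneg (by exact_mod_cast hn1)
  rw [div_lt_div_iff₀ hn (by positivity)] at hlt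
  calc Real.exp (-(κ * a n)) ≤ Real.exp (-(p * Real.log n)) := by
        refine Real.exp_le_exp.2 ?_
        nlinarith
    _ = ((n : ℝ) ^ p)⁻¹ := by rw [Real.exp_neg, ← Real.log_pow, Real.exp_log (pow_pos hn0 p)]

/-- Balls of polynomially growing radius have polynomially large nets of mesh `d / n ^ 4`. -/
theorem exists_polynomial_net (d : ℕ) (r : ℝ) :
    ∃ p : ℕ, ∀ n : ℕ, 2 ≤ n → ∃ G : Finset (Pt d), (G.card : ℝ) ≤ (n : ℝ) ^ p ∧
      ∀ x : Pt d, ‖x‖ ≤ (n : ℝ) ^ r → ∃ z ∈ G, ‖x - z‖ ≤ d / (n : ℝ) ^ 4 := by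
  classical
  obtain ⟨R, hR⟩ := exists_nat_ge r
  refine ⟨(R + 7) * d, fun n hn => ?_⟩
  have hn2 : (2 : ℝ) ≤ n := by exact_mod_cast hn
  have hn1 : (1 : ℝ) ≤ n := by linarith
  -- The net is a grid of spacing `n ^ (-4)`. Scaled coordinates are at most `n ^ (R + 4)`; rounding
  -- at most doubles this bound, and `2 ≤ n` absorbs the factor. Each coordinate has `2 * n ^ (R +
  -- 5) + 1 ≤ n ^ (R + 7)` values.
  set N : ℤ := (n : ℤ) ^ (R + 5) with hN
  refine ⟨(Fintype.piFinset fun _ : Fin d => Finset.Icc (-N) N).image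
    fun z => WithLp.toLp 2 fun i => (z i : ℝ) / (n : ℝ) ^ 4, ?_, ?_⟩
  · have h1 : ((Fintype.piFinset fun _ : Fin d => Finset.Icc (-N) N).card : ℝ) =
        (2 * (n : ℝ) ^ (R + 5) + 1) ^ d := by
      rw [Fintype.card_piFinset_const, Int.card_Icc, Nat.cast_pow]
      congr 1
      have h2 : (((N + 1 - -N).toNat : ℤ) : ℝ) = ((N + 1 - -N : ℤ) : ℝ) := by
        rw [Int.toNat_of_nonneg]
        have : 0 ≤ N := by positivity
        linarith
      rw [Int.cast_natCast] at h2
      rw [h2, hN]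
      push_cast
      ring
    refine le_trans (by exact_mod_cast Finset.card_image_le) (h1.le.trans ?_)
    rw [pow_mul]
    refine pow_le_pow_left₀ (by positivity) ?_ d
    have h3 : (1 : ℝ) ≤ (n : ℝ) ^ (R + 5) := one_le_pow₀ hn1
    have h4 : (4 : ℝ) ≤ (n : ℝ) ^ 2 := by nlinarith
    calc 2 * (n : ℝ) ^ (R + 5) + 1 ≤ (n : ℝ) ^ 2 * (n : ℝ) ^ (R + 5) := by nlinarith
      _ = (n : ℝ) ^ (R + 7) := by ring
  · intro x hx
    have hxR : ‖x‖ ≤ (n : ℝ) ^ R := by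
      refine hx.trans ?_
      rw [← Real.rpow_natCast]
      exact Real.rpow_le_rpow_of_exponent_le hn1 hR
    have hn4 : (0 : ℝ) < (n : ℝ) ^ 4 := by positivity
    refine ⟨_, Finset.mem_image_of_mem _ (Fintype.mem_piFinset.2 fun i => ?_ :
      (fun i => round (x i * (n : ℝ) ^ 4)) ∈ _), ?_⟩
    · have hxi : |x i| ≤ (n : ℝ) ^ R := (PiLp.norm_apply_le x i).trans hxR
      have h1 := abs_sub_round (x i * (n : ℝ) ^ 4)
      have h2 : |x i * (n : ℝ) ^ 4| ≤ (n : ℝ) ^ (R + 4) := by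
        rw [abs_mul, abs_of_pos hn4, pow_add]
        gcongr
      have h3 : (1 : ℝ) ≤ (n : ℝ) ^ (R + 4) := one_le_pow₀ hn1
      have h4 : 2 * (n : ℝ) ^ (R + 4) ≤ (n : ℝ) ^ (R + 5) := by
        rw [pow_succ _ (R + 4), mul_comm]
        gcongr
      have h5 : |((round (x i * (n : ℝ) ^ 4) : ℤ) : ℝ)| ≤ ((N : ℤ) : ℝ) := by
        rw [hN]
        push_cast
        rw [abs_le] at h1 h2 ⊢
        constructor <;> linarith [h1.1, h1.2, h2.1, h2.2]
      rw [Finset.mem_Icc, ← abs_le]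
      exact_mod_cast h5
    · rw [EuclideanSpace.norm_eq]
      refine Real.sqrt_le_iff.2 ⟨by positivity, ?_⟩
      calc _ ≤ ∑ _i : Fin d, (1 / (n : ℝ) ^ 4) ^ 2 := by
            refine Finset.sum_le_sum fun i _ => ?_
            refine pow_le_pow_left₀ (norm_nonneg _) ?_ 2
            have h1 := abs_sub_round (x i * (n : ℝ) ^ 4)
            rw [PiLp.sub_apply, Real.norm_eq_abs, le_div_iff₀ hn4]
            calc _ = |x i * (n : ℝ) ^ 4 - round (x i * (n : ℝ) ^ 4)| := by
                  rw [← abs_of_pos hn4, ← abs_mul, abs_of_pos hn4, sub_mul]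
                  congr 2
                  exact div_mul_cancel₀ _ hn4.ne'
              _ ≤ 1 := h1.trans (by norm_num)
        _ = d * (1 / (n : ℝ) ^ 4) ^ 2 := by simp
        _ ≤ (d / (n : ℝ) ^ 4) ^ 2 := by
            rw [div_pow, div_pow, one_pow, mul_one_div]
            gcongr
            rcases Nat.eq_zero_or_pos d with rfl | hd
            · simp
            · exact le_self_pow₀ (by exact_mod_cast hd) two_ne_zero

theorem tendsto_sum_Icc_div {u : ℕ → ℝ} {l : ℝ} (hu : Tendsto u atTop (𝓝 l)) :
    Tendsto (fun n : ℕ => (∑ k ∈ Finset.Icc 1 n, u k) / n) atTop (𝓝 l) := by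
  refine ((hu.comp (tendsto_add_atTop_nat 1)).cesaro).congr fun n => ?_
  rw [← Finset.Ico_add_one_right_eq_Icc, Finset.sum_Ico_eq_sum_range, div_eq_inv_mul]
  simp [add_comm]

/-! ### Law of large numbers for the weights -/

namespace SafeScheme

variable {d : ℕ} {f q₀ K : Pt d → ℝ} {lam h eta : ℕ → ℝ} {c U U₀ Kinf : ℝ}
  {Ω : Type*} [MeasurableSpace Ω] {P : Measure Ω} [IsProbabilityMeasure P] {X : ℕ → Ω → Pt d}

/-- The mean regularized weight converges to one. -/
theorem ae_tendsto_mean_weight (H : SafeScheme f q₀ K lam h eta c U U₀ Kinf)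
    (hX : HasPolicy P X fun k ω => proposal f q₀ K lam h eta (fun j => X j ω) k)
    (hlam_rate : Tendsto (fun k : ℕ => Real.log k / (k * lam k)) atTop (𝓝 0))
    (heta : Tendsto eta atTop (𝓝 1))
    (hlam : Tendsto (fun k : ℕ => (1 - eta k) * Real.log (lam (k - 1))) atTop (𝓝 0)) :
    ∀ᵐ ω ∂P, Tendsto (fun n : ℕ => (∑ k ∈ Finset.Icc 1 n,
      importanceWeight f q₀ K lam h eta (fun j => X j ω) k ^ eta k) / n) atTop (𝓝 1) := by
  -- Tolerances `1 / (i + 1)` are countably many, so their exceptional null sets can be united.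
  have hdev : ∀ i : ℕ, ∀ᵐ ω ∂P, ∀ᶠ n : ℕ in atTop, |∑ k ∈ Finset.Icc 1 n,
      (importanceWeight f q₀ K lam h eta (fun j => X j ω) k ^ eta k -
        ∫ y, tiltedTarget f q₀ K lam h eta k (fun j => X j ω) y)| < n * (1 / ((i : ℝ) + 1)) := by
    intro i
    obtain ⟨κ, hκ, hconc⟩ := H.exists_measure_abs_weighted_sum_sub_ge_le hX (m := 1)
      (t := 1 / ((i : ℝ) + 1)) one_pos (by positivity)
    have hrate := eventually_exp_neg_mul_le_inv_pow (a := fun n : ℕ => n * lam n)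
      ((eventually_ge_atTop 1).mono fun n hn =>
        mul_pos (by exact_mod_cast hn) (H.lam_mem n hn).1) hlam_rate hκ 2
    have hbc := ae_eventually_notMem_of_le_div_sq (P := P) (A := fun n : ℕ =>
      {ω | n * (1 / ((i : ℝ) + 1)) ≤ |∑ k ∈ Finset.Icc 1 n,
      (importanceWeight f q₀ K lam h eta (fun j => X j ω) k ^ eta k -
        ∫ y, tiltedTarget f q₀ K lam h eta k (fun j => X j ω) y)|}) (C := 2) (by
      filter_upwards [hrate, eventually_ge_atTop 1] with n hn hn1
      have h1 := hconc n hn1 1 one_pos (fun _ => 1) measurable_const (fun _ => zero_le_one)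
        (fun _ => le_rfl) (fun k hk x => by
          simpa using H.integral_tiltedTarget_le_one hk x)
      simp only [mul_one, div_one] at h1
      refine h1.trans (ENNReal.ofReal_le_ofReal ?_)
      rw [div_eq_mul_inv]
      exact mul_le_mul_of_nonneg_left hn zero_le_two)
    filter_upwards [hbc] with ω hω
    filter_upwards [hω] with n hn
    simpa only [Set.mem_ofPred_eq, not_le] using hn
  filter_upwards [ae_all_iff.2 hdev] with ω hω
  have hmart : Tendsto (fun n : ℕ => (∑ k ∈ Finset.Icc 1 n,
      (importanceWeight f q₀ K lam h eta (fun j => X j ω) k ^ eta k -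
        ∫ y, tiltedTarget f q₀ K lam h eta k (fun j => X j ω) y)) / n) atTop (𝓝 0) := by
    rw [Metric.tendsto_nhds]
    intro ε hε
    obtain ⟨i, hi⟩ := exists_nat_one_div_lt hε
    filter_upwards [hω i, eventually_ge_atTop 1] with n hn hn1
    have hn0 : (0 : ℝ) < n := by exact_mod_cast hn1
    rw [Real.dist_eq, sub_zero, abs_div, abs_of_pos hn0, div_lt_iff₀ hn0]
    nlinarith
  have hcomp : Tendsto (fun n : ℕ => (∑ k ∈ Finset.Icc 1 n,
      ∫ y, tiltedTarget f q₀ K lam h eta k (fun j => X j ω) y) / n) atTop (𝓝 1) := by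
    -- The conditional mean weights lie between `(c * drawMixture lam k) ^ (1 - eta k)` and `1`;
    -- both bounds tend to one.
    refine tendsto_sum_Icc_div (tendsto_of_tendsto_of_tendsto_of_le_of_le'
      (H.tendsto_mul_log_mixture heta hlam) tendsto_const_nhds ?_ ?_)
    · filter_upwards [eventually_ge_atTop 1] with k hk
      exact H.rpow_le_integral_tiltedTarget hk _
    · filter_upwards [eventually_ge_atTop 1] with k hk
      exact H.integral_tiltedTarget_le_one hk _
  have hadd := hmart.add hcomp
  rw [zero_add] at hadd
  refine hadd.congr fun n => ?_
  rw [← add_div, ← Finset.sum_add_distrib]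
  simp

end SafeScheme

/-! ### First moment of the kernel and smoothing bias -/

section Kernel

variable {d : ℕ} {K : Pt d → ℝ}

theorem norm_mul_scaledKernel_eq (K : Pt d → ℝ) {b : ℝ} (hb : 0 < b) (u : Pt d) :
    ‖u‖ * scaledKernel K b u = b / b ^ d * (‖b⁻¹ • u‖ * K (b⁻¹ • u)) := by
  have hbd := (pow_pos hb d).ne'
  rw [scaledKernel, norm_smul, norm_inv, Real.norm_eq_abs, abs_of_pos hb]
  field_simp

theorem integrable_norm_mul_scaledKernel (hK : Integrable fun u => ‖u‖ * K u) {b : ℝ}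
    (hb : 0 < b) (z : Pt d) : Integrable fun y => ‖z - y‖ * scaledKernel K b (z - y) := by
  have h1 : Integrable fun u => ‖u‖ * scaledKernel K b u := by
    simp only [norm_mul_scaledKernel_eq K hb]
    exact (hK.comp_smul (inv_ne_zero hb.ne')).const_mul _
  exact h1.comp_sub_left z

theorem integral_norm_mul_scaledKernel (K : Pt d → ℝ) {b : ℝ} (hb : 0 < b) (z : Pt d) :
    ∫ y, ‖z - y‖ * scaledKernel K b (z - y) = b * ∫ u, ‖u‖ * K u := by
  have hbd := pow_pos hb d
  rw [integral_sub_left_eq_self (fun u => ‖u‖ * scaledKernel K b u)]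
  simp only [norm_mul_scaledKernel_eq K hb]
  rw [integral_const_mul, Measure.integral_comp_smul volume (fun u => ‖u‖ * K u)]
  simp only [finrank_euclideanSpace, Fintype.card_fin, inv_pow, inv_inv, smul_eq_mul]
  rw [abs_of_pos hbd]
  field_simp

end Kernel

namespace SafeScheme

variable {d : ℕ} {f q₀ K : Pt d → ℝ} {lam h eta : ℕ → ℝ} {c U U₀ Kinf : ℝ}

theorem integrable_tiltedTarget_mul (H : SafeScheme f q₀ K lam h eta c U U₀ Kinf) {k : ℕ}
    (hk : 1 ≤ k) (x : ℕ → Pt d) {b : ℝ} (hb : 0 < b) (z : Pt d) :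
    Integrable fun y => tiltedTarget f q₀ K lam h eta k x y * scaledKernel K b (z - y) := by
  have hden := (H.kernel.scaledKernel hb).comp_sub_left z
  refine (H.integrable_tiltedTarget hk x).mul_bdd (c := Kinf / b ^ d)
    hden.measurable.aestronglyMeasurable (ae_of_all _ fun y => ?_)
  rw [Real.norm_eq_abs, abs_of_nonneg (hden.nonneg y)]
  exact scaledKernel_le H.kernel_le hb _

/-- The bound does not involve the bandwidth `b`. This keeps the loss in the Chernoff exponent at a
single factor `h n ^ d`. -/
theorem integral_tiltedTarget_mul_le (H : SafeScheme f q₀ K lam h eta c U U₀ Kinf) {k : ℕ}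
    (hk : 1 ≤ k) (x : ℕ → Pt d) {b : ℝ} (hb : 0 < b) (z : Pt d) :
    ∫ y, tiltedTarget f q₀ K lam h eta k x y * scaledKernel K b (z - y) ≤
      U + tiltError d lam h eta c U (1 + Kinf + U₀ * h 1 ^ d) k := by
  have hden := (H.kernel.scaledKernel hb).comp_sub_left z
  set e := tiltError d lam h eta c U (1 + Kinf + U₀ * h 1 ^ d) k with he
  calc _ ≤ ∫ y, (U + e) * scaledKernel K b (z - y) := by
        refine integral_mono (H.integrable_tiltedTarget_mul hk x hb z)
          (hden.integrable.const_mul _) fun y => mul_le_mul_of_nonneg_right ?_ (hden.nonneg y)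
        have h1 := (abs_le.1 (H.abs_tiltedTarget_sub_le hk x y)).2
        have h2 := H.target_le y
        linarith
    _ = U + e := by rw [integral_const_mul, hden.integral_eq_one, mul_one]

/-- Bias of the smoothed conditional density of the weighted draws. -/
theorem abs_integral_tiltedTarget_mul_sub_le (H : SafeScheme f q₀ K lam h eta c U U₀ Kinf)
    {L : NNReal} (hL : LipschitzWith L f) (hmom : Integrable fun u => ‖u‖ * K u) {k : ℕ}
    (hk : 1 ≤ k) (x : ℕ → Pt d) {b : ℝ} (hb : 0 < b) (z : Pt d) :
    |(∫ y, tiltedTarget f q₀ K lam h eta k x y * scaledKernel K b (z - y)) - f z| ≤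
      tiltError d lam h eta c U (1 + Kinf + U₀ * h 1 ^ d) k + L * (b * ∫ u, ‖u‖ * K u) := by
  have hden := (H.kernel.scaledKernel hb).comp_sub_left z
  set e := tiltError d lam h eta c U (1 + Kinf + U₀ * h 1 ^ d) k with he
  have hint1 := H.integrable_tiltedTarget_mul hk x hb z
  have hint2 := integrable_norm_mul_scaledKernel hmom hb z
  -- The kernel has mass one, so `f z` can be moved under the integral; the difference then splits
  -- into the tilt error and the Lipschitz increment of `f`.
  have h1 : (∫ y, tiltedTarget f q₀ K lam h eta k x y * scaledKernel K b (z - y)) - f z =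
      ∫ y, (tiltedTarget f q₀ K lam h eta k x y * scaledKernel K b (z - y) -
        f z * scaledKernel K b (z - y)) := by
    rw [integral_sub hint1 (hden.integrable.const_mul _), integral_const_mul,
      hden.integral_eq_one, mul_one]
  have h2 : e + L * (b * ∫ u, ‖u‖ * K u) = ∫ y, (e * scaledKernel K b (z - y) +
      L * (‖z - y‖ * scaledKernel K b (z - y))) := by
    rw [integral_add (hden.integrable.const_mul _) (hint2.const_mul _), integral_const_mul,
      integral_const_mul, hden.integral_eq_one, mul_one, integral_norm_mul_scaledKernel K hb]
  rw [h1, h2]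
  refine abs_integral_le_integral_abs.trans (integral_mono
    (hint1.sub (hden.integrable.const_mul _)).abs
    ((hden.integrable.const_mul _).add (hint2.const_mul _)) fun y => ?_)
  simp only
  rw [← sub_mul, abs_mul, abs_of_nonneg (hden.nonneg y), ← mul_assoc, ← add_mul]
  refine mul_le_mul_of_nonneg_right ?_ (hden.nonneg y)
  have h3 := H.abs_tiltedTarget_sub_le hk x y
  have h4 := hL.dist_le_mul y z
  rw [Real.dist_eq, dist_comm, dist_eq_norm] at h4
  calc |tiltedTarget f q₀ K lam h eta k x y - f z|
      = |(tiltedTarget f q₀ K lam h eta k x y - f y) + (f y - f z)| := by congr 1; ring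
    _ ≤ _ := abs_add_le _ _
    _ ≤ _ := add_le_add h3 h4

/-! ### Uniform convergence of the kernel sums -/

/-- The weighted kernel sum `∑ k ≤ n, W_k ^ eta k * K_{h n} (z - x k)`. -/
noncomputable def _root_.kernelSum (f q₀ K : Pt d → ℝ) (lam h eta : ℕ → ℝ) (x : ℕ → Pt d)
    (n : ℕ) (z : Pt d) : ℝ :=
  ∑ k ∈ Finset.Icc 1 n, importanceWeight f q₀ K lam h eta x k ^ eta k *
    scaledKernel K (h n) (z - x k)

/-- A crude Lipschitz bound, using the worst weight for every term, suffices: under the rate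
conditions its constant is eventually polynomial in `n`, and the net can be refined accordingly. -/
theorem abs_kernelSum_sub_le (H : SafeScheme f q₀ K lam h eta c U U₀ Kinf) {LK : NNReal}
    (hLK : LipschitzWith LK K) {n : ℕ} (hn : 1 ≤ n) (x : ℕ → Pt d) (z z' : Pt d) :
    |kernelSum f q₀ K lam h eta x n z - kernelSum f q₀ K lam h eta x n z'| ≤
      n * ((1 + 1 / c) / lam n * (LK / h n ^ (d + 1) * ‖z - z'‖)) := by
  unfold kernelSum
  rw [← Finset.sum_sub_distrib]
  refine (Finset.abs_sum_le_sum_abs _ _).trans ?_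
  have hcard : (n : ℝ) = ∑ _k ∈ Finset.Icc 1 n, (1 : ℝ) := by simp
  rw [hcard, Finset.sum_mul]
  refine Finset.sum_le_sum fun k hk => ?_
  have hw : 0 ≤ importanceWeight f q₀ K lam h eta x k ^ eta k :=
    Real.rpow_nonneg (H.importanceWeight_nonneg k x) _
  have hk1 := abs_scaledKernel_sub_le hLK (H.h_pos n hn) (z - x k) (z' - x k)
  rw [sub_sub_sub_cancel_right] at hk1
  rw [← mul_sub, abs_mul, abs_of_nonneg hw, one_mul]
  exact mul_le_mul (H.div_rpow_le hk x (x k)) hk1 (abs_nonneg _)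
    (hw.trans (H.div_rpow_le hk x (x k)))

variable {Ω : Type*} [MeasurableSpace Ω] {P : Measure Ω} [IsProbabilityMeasure P]
  {X : ℕ → Ω → Pt d}

/-- On a polynomially large net, the kernel sums are close to their compensators. -/
theorem ae_eventually_net_deviation_lt (H : SafeScheme f q₀ K lam h eta c U U₀ Kinf)
    (hX : HasPolicy P X fun k ω => proposal f q₀ K lam h eta (fun j => X j ω) k)
    (hh_rate : Tendsto (fun k : ℕ => Real.log k / (k * h k ^ d * lam k)) atTop (𝓝 0))
    (herr : Tendsto (tiltError d lam h eta c U (1 + Kinf + U₀ * h 1 ^ d)) atTop (𝓝 0))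
    {G : ℕ → Finset (Pt d)} {p : ℕ} (hG : ∀ n, 2 ≤ n → ((G n).card : ℝ) ≤ (n : ℝ) ^ p)
    {t : ℝ} (ht : 0 < t) :
    ∀ᵐ ω ∂P, ∀ᶠ n : ℕ in atTop, ∀ z ∈ G n, |kernelSum f q₀ K lam h eta (fun j => X j ω) n z -
      ∑ k ∈ Finset.Icc 1 n, ∫ y, tiltedTarget f q₀ K lam h eta k (fun j => X j ω) y *
        scaledKernel K (h n) (z - y)| < n * t := by
  obtain ⟨E, hE⟩ := herr.bddAbove_range
  have hE' : ∀ k, tiltError d lam h eta c U (1 + Kinf + U₀ * h 1 ^ d) k ≤ E :=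
    fun k => hE (Set.mem_range_self k)
  -- The concentration bound asks for `B > 0`, while `Kinf` is only known to be nonnegative.
  have hK1 : 0 < Kinf + 1 := by linarith [H.kernelBound_nonneg]
  obtain ⟨κ, hκ, hconc⟩ := H.exists_measure_abs_weighted_sum_sub_ge_le hX
    (m := max 1 (U + E)) (t := t) (lt_max_of_lt_left one_pos) ht
  -- Of the power `p + 2`, `p` pays for the union over the net and `2` for summability.
  have hrate := eventually_exp_neg_mul_le_inv_pow (a := fun n : ℕ => n * h n ^ d * lam n)
    ((eventually_ge_atTop 1).mono fun n hn => mul_pos (mul_pos (by exact_mod_cast hn)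
      (pow_pos (H.h_pos n hn) d)) (H.lam_mem n hn).1) hh_rate (div_pos hκ hK1) (p + 2)
  have hbc := ae_eventually_notMem_of_le_div_sq (P := P) (A := fun n : ℕ =>
    ⋃ z ∈ G n, {ω | n * t ≤ |∑ k ∈ Finset.Icc 1 n,
        (importanceWeight f q₀ K lam h eta (fun j => X j ω) k ^ eta k *
          scaledKernel K (h n) (z - X k ω) -
          ∫ y, tiltedTarget f q₀ K lam h eta k (fun j => X j ω) y *
            scaledKernel K (h n) (z - y))|}) (C := 2) (by
    filter_upwards [hrate, eventually_ge_atTop 2] with n hn hn2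
    have hn1 : 1 ≤ n := by omega
    have hn0 : (0 : ℝ) < n := by exact_mod_cast hn1
    have hhn := H.h_pos n hn1
    have hbound : ∀ z ∈ G n, _ ≤ ENNReal.ofReal (2 * ((n : ℝ) ^ (p + 2))⁻¹) := fun z _ => by
      have hden := (H.kernel.scaledKernel hhn).comp_sub_left z
      refine (hconc n hn1 ((Kinf + 1) / h n ^ d) (div_pos hK1 (pow_pos hhn d))
        (fun y => scaledKernel K (h n) (z - y)) hden.measurable hden.nonneg (fun y =>
          (scaledKernel_le (Kinf := Kinf + 1) (fun u => by linarith [H.kernel_le u]) hhn _))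
        (fun k hk x => ?_)).trans (ENNReal.ofReal_le_ofReal ?_)
      · refine (H.integral_tiltedTarget_mul_le hk x hhn z).trans (le_max_of_le_right ?_)
        linarith [hE' k]
      · refine mul_le_mul_of_nonneg_left (le_trans (le_of_eq ?_) hn) zero_le_two
        congr 2
        field_simp
    refine (measure_biUnion_finset_le _ _).trans ((Finset.sum_le_sum hbound).trans ?_)
    rw [Finset.sum_const, ← ENNReal.ofReal_nsmul, nsmul_eq_mul]
    refine ENNReal.ofReal_le_ofReal ?_
    calc ((G n).card : ℝ) * (2 * ((n : ℝ) ^ (p + 2))⁻¹)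
        ≤ (n : ℝ) ^ p * (2 * ((n : ℝ) ^ (p + 2))⁻¹) := by
          gcongr
          exact hG n hn2
      _ = 2 / (n : ℝ) ^ 2 := by
          rw [pow_add]
          field_simp)
  filter_upwards [hbc] with ω hω
  filter_upwards [hω] with n hn z hz
  simp only [Set.mem_iUnion, Set.mem_ofPred_eq, not_exists, not_le, Finset.sum_sub_distrib] at hn
  exact hn z hz

/-- The rate condition on the bandwidths yields polynomial lower bounds. -/
theorem eventually_one_le_mul (H : SafeScheme f q₀ K lam h eta c U U₀ Kinf) (hd : 1 ≤ d)
    (hh_lim : Tendsto h atTop (𝓝 0))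
    (hh_rate : Tendsto (fun k : ℕ => Real.log k / (k * h k ^ d * lam k)) atTop (𝓝 0)) :
    ∀ᶠ n : ℕ in atTop, 1 ≤ n * lam n ∧ 1 ≤ n * h n ∧ 1 ≤ n * h n ^ d := by
  have hlog : ∀ᶠ n : ℕ in atTop, 1 ≤ Real.log n :=
    (Real.tendsto_log_atTop.comp tendsto_natCast_atTop_atTop).eventually_ge_atTop 1
  filter_upwards [hlog, hh_lim.eventually_le_const one_pos, hh_rate.eventually_le_const one_pos,
    eventually_ge_atTop 1] with n hlogn hh1 hr hn
  have hn0 : (0 : ℝ) < n := by exact_mod_cast hn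
  have hhn := H.h_pos n hn
  have hlam := H.lam_mem n hn
  have hhd := pow_pos hhn d
  have hhd1 : h n ^ d ≤ 1 := pow_le_one₀ hhn.le hh1
  -- This comparison is where `1 ≤ d` matters.
  have hhd2 : h n ^ d ≤ h n := pow_le_of_le_one hhn.le hh1 (by omega)
  rw [div_le_one (mul_pos (mul_pos hn0 hhd) hlam.1)] at hr
  have h1 : 1 ≤ n * h n ^ d * lam n := hlogn.trans hr
  have h2 : n * h n ^ d * lam n ≤ n * lam n := by
    calc n * h n ^ d * lam n ≤ n * 1 * lam n := by
          have := hlam.1.le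
          gcongr
      _ = n * lam n := by ring
  have h3 : n * h n ^ d * lam n ≤ n * h n ^ d :=
    mul_le_of_le_one_right (mul_pos hn0 hhd).le hlam.2
  have h4 : n * h n ^ d ≤ n * h n := by gcongr
  exact ⟨h1.trans h2, h1.trans (h3.trans h4), h1.trans h3⟩

/-- The normalized kernel sums converge to the target uniformly on growing balls. -/
theorem ae_eventually_abs_kernelSum_div_sub_le (H : SafeScheme f q₀ K lam h eta c U U₀ Kinf)
    (hd : 1 ≤ d)
    (hX : HasPolicy P X fun k ω => proposal f q₀ K lam h eta (fun j => X j ω) k)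
    (hh_lim : Tendsto h atTop (𝓝 0))
    (hh_rate : Tendsto (fun k : ℕ => Real.log k / (k * h k ^ d * lam k)) atTop (𝓝 0))
    (herr : Tendsto (tiltError d lam h eta c U (1 + Kinf + U₀ * h 1 ^ d)) atTop (𝓝 0))
    {L LK : NNReal} (hL : LipschitzWith L f) (hLK : LipschitzWith LK K)
    (hmom : Integrable fun u => ‖u‖ * K u) (r : ℝ) {ε : ℝ} (hε : 0 < ε) :
    ∀ᵐ ω ∂P, ∀ᶠ n : ℕ in atTop, ∀ z : Pt d, ‖z‖ ≤ (n : ℝ) ^ r →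
      |kernelSum f q₀ K lam h eta (fun j => X j ω) n z / n - f z| ≤ ε := by
  obtain ⟨p, hp⟩ := exists_polynomial_net d r
  choose! G hGcard hGnet using hp
  have hdev := H.ae_eventually_net_deviation_lt hX hh_rate herr hGcard
    (t := ε / 4) (by positivity)
  -- The tilt error varies with the draw and is averaged over `k ≤ n`, whereas the smoothing bias
  -- uses the bandwidth `h n` for every draw. The budget is `ε / 8` for moving the kernel sum to the
  -- net, `ε / 4` for the deviation, `ε / 2` for the two biases and `ε / 8` for moving `f`.
  have hmean := (tendsto_sum_Icc_div herr).eventually_lt_const (show 0 < ε / 4 by positivity)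
  have hbw : Tendsto (fun n => L * (h n * ∫ u, ‖u‖ * K u)) atTop (𝓝 0) := by
    simpa using (hh_lim.mul_const (∫ u, ‖u‖ * K u)).const_mul (L : ℝ)
  have hbw' := hbw.eventually_lt_const (show 0 < ε / 4 by positivity)
  have hmesh1 := (tendsto_const_div_atTop_nhds_zero_nat ((1 + 1 / c) * LK * d)).eventually_lt_const
    (show 0 < ε / 8 by positivity)
  have hmesh2 := (tendsto_const_div_atTop_nhds_zero_nat ((L : ℝ) * d)).eventually_lt_const
    (show 0 < ε / 8 by positivity)
  filter_upwards [hdev] with ω hω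
  filter_upwards [hω, hmean, hbw', hmesh1, hmesh2, H.eventually_one_le_mul hd hh_lim hh_rate,
    eventually_ge_atTop 2] with n hdevn hmeann hbwn hm1 hm2 hlow hn2 x hx
  have hn1 : 1 ≤ n := by omega
  have hn0 : (0 : ℝ) < n := by exact_mod_cast hn1
  have hn1' : (1 : ℝ) ≤ n := by exact_mod_cast hn1
  have hhn := H.h_pos n hn1
  have hlam := H.lam_mem n hn1
  have hc := H.c_pos
  obtain ⟨z, hz, hxz⟩ := hGnet n hn2 x hx
  set e := tiltError d lam h eta c U (1 + Kinf + U₀ * h 1 ^ d) with he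
  set S := kernelSum f q₀ K lam h eta (fun j => X j ω) n with hS
  set μ : ℕ → ℝ := fun k => ∫ y, tiltedTarget f q₀ K lam h eta k (fun j => X j ω) y *
        scaledKernel K (h n) (z - y) with hμ
  have hcard : (n : ℝ) = ∑ _k ∈ Finset.Icc 1 n, (1 : ℝ) := by simp
  have h1 : |S x - S z| ≤ n * (ε / 8) := by
    refine (H.abs_kernelSum_sub_le hLK hn1 _ x z).trans (mul_le_mul_of_nonneg_left ?_ hn0.le)
    refine le_trans ?_ hm1.le
    -- Together with the next bound this makes the Lipschitz constant of the normalized sum `O(n ^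
    -- 3)`, so the mesh `d / n ^ 4` leaves `O(1 / n)`.
    have hl : 1 / lam n ≤ n := by
      rw [div_le_iff₀ hlam.1]
      exact hlow.1
    have hh : 1 / h n ^ (d + 1) ≤ n * n := by
      rw [div_le_iff₀ (pow_pos hhn _), pow_succ]
      calc (1 : ℝ) ≤ (n * h n ^ d) * (n * h n) :=
            one_le_mul_of_one_le_of_one_le hlow.2.2 hlow.2.1
        _ = _ := by ring
    calc (1 + 1 / c) / lam n * (LK / h n ^ (d + 1) * ‖x - z‖)
        = (1 + 1 / c) * LK * ((1 / lam n) * (1 / h n ^ (d + 1)) * ‖x - z‖) := by ring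
      _ ≤ (1 + 1 / c) * LK * (n * (n * n) * (d / (n : ℝ) ^ 4)) := by
          have : 0 < 1 / h n ^ (d + 1) := by positivity
          gcongr
      _ = (1 + 1 / c) * LK * d / n := by
          field_simp
  have h2 : |S z - ∑ k ∈ Finset.Icc 1 n, μ k| ≤ n * (ε / 4) := (hdevn z hz).le
  have h3 : |∑ k ∈ Finset.Icc 1 n, μ k - n * f z| ≤ n * (ε / 2) := by
    have h4 : ∑ k ∈ Finset.Icc 1 n, μ k - n * f z = ∑ k ∈ Finset.Icc 1 n, (μ k - f z) := by
      rw [Finset.sum_sub_distrib]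
      simp
    rw [h4]
    calc |∑ k ∈ Finset.Icc 1 n, (μ k - f z)|
        ≤ ∑ k ∈ Finset.Icc 1 n, (e k + L * (h n * ∫ u, ‖u‖ * K u)) :=
          (Finset.abs_sum_le_sum_abs _ _).trans (Finset.sum_le_sum fun k hk =>
            H.abs_integral_tiltedTarget_mul_sub_le hL hmom (Finset.mem_Icc.1 hk).1 _ hhn z)
      _ = ∑ k ∈ Finset.Icc 1 n, e k + n * (L * (h n * ∫ u, ‖u‖ * K u)) := by
          rw [Finset.sum_add_distrib]
          simp
      _ ≤ n * (ε / 4) + n * (ε / 4) := by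
          rw [div_lt_iff₀ hn0] at hmeann
          have := mul_le_mul_of_nonneg_left hbwn.le hn0.le
          linarith
      _ = n * (ε / 2) := by ring
  have h5 : |f z - f x| ≤ ε / 8 := by
    have h6 := hL.dist_le_mul z x
    rw [Real.dist_eq, dist_comm, dist_eq_norm] at h6
    refine h6.trans (le_trans ?_ hm2.le)
    rw [mul_div_assoc]
    refine mul_le_mul_of_nonneg_left (hxz.trans ?_) L.2
    have : (n : ℝ) ≤ (n : ℝ) ^ 4 := le_self_pow₀ hn1' (by norm_num)
    gcongr
  have h7 : |S x - n * f x| ≤ n * ε := by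
    have h8 : |n * f z - n * f x| ≤ n * (ε / 8) := by
      rw [← mul_sub, abs_mul, abs_of_pos hn0]
      gcongr
    rw [abs_le] at *
    constructor <;> linarith [h1.1, h1.2, h2.1, h2.2, h3.1, h3.2, h8.1, h8.2]
  have h9 : S x / n - f x = (S x - n * f x) / n := by
    field_simp
  rw [h9, abs_div, abs_of_pos hn0, div_le_iff₀ hn0]
  linarith

end SafeScheme

/-! ### From the ratio to the estimate -/

theorem targetEstimate_eq_div {d : ℕ} (f q₀ K : Pt d → ℝ) (lam h eta : ℕ → ℝ) (x : ℕ → Pt d)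
    {n : ℕ} (hV : ∑ k ∈ Finset.Icc 1 n, importanceWeight f q₀ K lam h eta x k ^ eta k ≠ 0)
    (y : Pt d) : targetEstimate f q₀ K lam h eta x n y = kernelSum f q₀ K lam h eta x n y /
      ∑ k ∈ Finset.Icc 1 n, importanceWeight f q₀ K lam h eta x k ^ eta k := by
  unfold targetEstimate weightedKDE kernelSum normalizedWeight
  simp only [if_neg hV]
  rw [Finset.sum_div]
  exact Finset.sum_congr rfl fun k _ => by ring

/-- Stability of a quotient near `b / 1`: the error is `((a - b) - b * (v - 1)) / v`, and `η ≤ 1 /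
2` keeps `v ≥ 1 / 2`. -/
theorem abs_div_sub_le {a v b U η : ℝ} (hb0 : 0 ≤ b) (hbU : b ≤ U) (hv : |v - 1| ≤ η)
    (hη : η ≤ 1 / 2) (ha : |a - b| ≤ η) : |a / v - b| ≤ 2 * ((1 + U) * η) := by
  have hv2 : 1 / 2 ≤ v := by linarith [(abs_le.1 hv).1]
  have hv0 : 0 < v := by linarith
  have hη0 : 0 ≤ η := (abs_nonneg _).trans hv
  have h1 : a / v - b = (a - b - b * (v - 1)) / v := by
    field_simp
    ring
  have h2 : |b * (v - 1)| ≤ U * η := by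
    rw [abs_mul, abs_of_nonneg hb0]
    exact mul_le_mul hbU hv (abs_nonneg _) (hb0.trans hbU)
  have h3 : |a - b - b * (v - 1)| ≤ (1 + U) * η := by
    rw [abs_le] at *
    constructor <;> linarith [ha.1, ha.2, h2.1, h2.2]
  have h4 : 0 ≤ (1 + U) * η := (abs_nonneg _).trans h3
  rw [h1, abs_div, abs_of_pos hv0, div_le_iff₀ hv0]
  nlinarith

/-- Taken in `[0, ∞]`, the supremum needs no proof of boundedness, and points outside the ball
contribute zero. -/
theorem proposition1 {Ω : Type*} [MeasurableSpace Ω] (P : Measure Ω) [IsProbabilityMeasure P]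
    (d : ℕ) (hd : 1 ≤ d)
    -- target density, safe density, kernel
    (f q₀ K : Pt d → ℝ)
    (hf : IsProbDensity f) (hq₀ : IsProbDensity q₀) (hK : IsProbDensity K)
    -- mixture weights, bandwidths, learning rates (indexed by `k ≥ 1`)
    (lam h eta : ℕ → ℝ)
    -- the particles, generated by the algorithm
    (X : ℕ → Ω → Pt d)
    (hX : HasPolicy P X
      (fun k ω => proposal f q₀ K lam h eta (fun j => X j ω) k))
    -- conditions on the sequences
    (hlam_mem : ∀ k, 1 ≤ k → lam k ∈ Set.Ioc (0 : ℝ) 1)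
    (hlam_anti : AntitoneOn lam (Set.Ici 1))
    (hlam_lim : Tendsto lam atTop (𝓝 0))
    (hlam_rate : Tendsto (fun k : ℕ => Real.log k / (k * lam k)) atTop (𝓝 0))
    (hh_pos : ∀ k, 1 ≤ k → 0 < h k)
    (hh_anti : AntitoneOn h (Set.Ici 1))
    (hh_lim : Tendsto h atTop (𝓝 0))
    (hh_rate : Tendsto (fun k : ℕ => Real.log k / (k * h k ^ d * lam k)) atTop (𝓝 0))
    (heta_mem : ∀ k, 1 ≤ k → eta k ∈ Set.Ioc (0 : ℝ) 1)
    (heta_lim : Tendsto eta atTop (𝓝 1))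
    (heta_h : Tendsto (fun k : ℕ => (1 - eta k) * Real.log (h k)) atTop (𝓝 0))
    (heta_lam : Tendsto (fun k : ℕ => (1 - eta k) * Real.log (lam (k - 1))) atTop (𝓝 0))
    -- the safe density is bounded and dominates the target
    (hq₀_bdd : ∃ U₀ : ℝ, ∀ x, q₀ x ≤ U₀)
    (c : ℝ) (hc : 0 < c) (hcf : ∀ x, c * f x ≤ q₀ x)
    -- the target is Lipschitz and bounded
    (L : NNReal) (hf_lip : LipschitzWith L f)
    (U : ℝ) (hf_bdd : ∀ x, f x ≤ U)
    -- conditions on the kernel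
    (hK_mom : Integrable (fun u => ‖u‖ * K u))
    (hK_sqrt : Integrable (fun u => Real.sqrt (K u)))
    (hK_sqrt_mom : Integrable (fun u => ‖u‖ * Real.sqrt (K u)))
    (Kinf : ℝ) (hK_bdd : ∀ u, K u ≤ Kinf)
    (LK : NNReal) (hLK : 0 < LK) (hK_lip : LipschitzWith LK K) :
    ∀ r : ℝ, 0 < r → ∀ᵐ ω ∂P,
      Tendsto
        (fun n : ℕ => ⨆ x ∈ Metric.closedBall (0 : Pt d) ((n : ℝ) ^ r),
          ENNReal.ofReal |targetEstimate f q₀ K lam h eta (fun j => X j ω) n x - f x|)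
        atTop (𝓝 0) := by
  intro r _
  obtain ⟨U₀, hU₀⟩ := hq₀_bdd
  have H : SafeScheme f q₀ K lam h eta c U U₀ Kinf :=
    ⟨hf, hq₀, hK, hlam_mem, hlam_anti, hh_pos, hh_anti, heta_mem, hc, hcf, hf_bdd, hU₀, hK_bdd⟩
  have herr := H.tendsto_tiltError heta_lim heta_h heta_lam H.proposalBound_pos
  have hV := H.ae_tendsto_mean_weight hX hlam_rate heta_lim heta_lam
  have hS : ∀ᵐ ω ∂P, ∀ i : ℕ, ∀ᶠ n : ℕ in atTop, ∀ z : Pt d, ‖z‖ ≤ (n : ℝ) ^ r →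
      |kernelSum f q₀ K lam h eta (fun j => X j ω) n z / n - f z| ≤ 1 / ((i : ℝ) + 1) :=
    ae_all_iff.2 fun i => H.ae_eventually_abs_kernelSum_div_sub_le hd hX hh_lim hh_rate herr
      hf_lip hK_lip hK_mom r (by positivity)
  filter_upwards [hV, hS] with ω hVω hSω
  have hU0 := H.targetBound_nonneg
  rw [ENNReal.tendsto_nhds_zero]
  intro ε hε
  obtain ⟨δ, hδ0, hδε⟩ := ENNReal.lt_iff_exists_nnreal_btwn.1 hε
  have hδ : (0 : ℝ) < δ := by exact_mod_cast hδ0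
  -- The second entry makes the quotient error `2 * (1 + U) * η` at most `δ`.
  set η : ℝ := min (1 / 2) (δ / (2 * (1 + U))) with hη
  have hη0 : 0 < η := lt_min (by norm_num) (by positivity)
  obtain ⟨i, hi⟩ := exists_nat_one_div_lt hη0
  filter_upwards [hSω i, Metric.tendsto_nhds.1 hVω η hη0, eventually_ge_atTop 1]
    with n hSn hVn hn
  have hn0 : (n : ℝ) ≠ 0 := by positivity
  rw [Real.dist_eq] at hVn
  -- A mean weight close to one rules out the equal-weights default.
  have hne : ∑ k ∈ Finset.Icc 1 n,
      importanceWeight f q₀ K lam h eta (fun j => X j ω) k ^ eta k ≠ 0 := by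
    intro h0
    rw [h0, zero_div, zero_sub, abs_neg, abs_one] at hVn
    linarith [min_le_left (1 / 2 : ℝ) (δ / (2 * (1 + U)))]
  refine iSup₂_le fun x hx => le_trans ?_ hδε.le
  rw [← ENNReal.ofReal_coe_nnreal]
  refine ENNReal.ofReal_le_ofReal ?_
  rw [mem_closedBall_zero_iff] at hx
  rw [targetEstimate_eq_div _ _ _ _ _ _ _ hne, ← div_div_div_cancel_right₀ hn0]
  refine (abs_div_sub_le (hf.nonneg x) (hf_bdd x) hVn.le (min_le_left _ _)
    ((hSn x hx).trans hi.le)).trans ?_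
  calc 2 * ((1 + U) * η) ≤ 2 * ((1 + U) * (δ / (2 * (1 + U)))) := by
        gcongr
        exact min_le_right _ _
    _ = δ := by field_simp
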